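/- **Setting.** Let $n\ge 1$, $D=\mathrm{diag}(d_1,\dots,d_n)$ with all $d_i>0$, and $G\in C^3(\mathbb R^n,\mathbb R)$. On $\mathbb R^{2n}=\mathbb R^n\times\mathbb R^n$ consider the Hamiltonian system $$(v,w)'=-J\nabla H(v,w),\qquad H(v,w)=\tfrac12\langle w,D^{-1}w\rangle+G(v),\qquad J=\begin{pmatrix}0&-I\\ I&0\end{pmatrix},$$ that is, $v'=D^{-1}w$, $w'=-\nabla G(v)$. All vector norms are Euclidean, and norms of matrices and of multilinear maps are the induced operator norms. Write $\pi_1(v,w)=v$. Let $p_0$ be an equilibrium, $A_0\in\mathbb R^{2n\times 2n}$ invertible, $\psi(z)=p_0+A_0z$, and $f(z)=-A_0^{-1}J\nabla H(\psi(z))$. Fix $r_u,\vartheta>0$, put $r_s=\vartheta r_u$ and, writing $z=(x,y)\in\mathbb R^n\times\mathbb R^n$, let $S=\{(x,y):|x|\le r_u,\ |y|\le r_s\}$. For a square matrix $A$ let $l(A)$ and $m_l(A)$ be the largest and the smallest eigenvalue of $(A+A^T)/2$. For a matrix function $F$ on $S$ let $[F(S)]$ be the set of matrices whose $(i,j)$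 entry lies between the infimum and the supremum over $S$ of $F_{ij}$, for all $i,j$. Define $$\mu=\sup_{z\in S}\Big\{l\big(\pi_y\tfrac{\partial f}{\partial y}(z)\big)+\tfrac1\vartheta\big\|\pi_y\tfrac{\partial f}{\partial x}(z)\big\|\Big\},\qquad \xi=\inf_{A\in[\pi_x\frac{\partial f}{\partial x}(S)]}m_l(A)-\sup_{A'\in[\pi_x\frac{\partial f}{\partial y}(S)]}\vartheta\|A'\| .$$ Assume the hypotheses of the unstable manifold theorem: 1. $\langle\pi_xf(q),\pi_xq\rangle>0$ for all $q\in S$ with $|\pi_xq|=r_u$; 2. $\langle\pi_yf(q),\pi_yq\rangle<0$ for all $q\in S$ with $|\pi_yq|=r_s$; 3. $\mu<0<\xi$. Let $W^u_{loc}(p_0)$ be the image under $\psi$ of the local unstable manifold of $0$ for $z'=f(z)$ in $S$, i.e. of the set of points having a backward orbit that stays in $S$ and converges to $0$. Let $\phi=(\varphi,D\varphi_x):\mathbb R\to\mathbb R^{2n}$ be a heteroclinic orbit of the Hamiltonian system, i.e. a solution with $\phi(x)\to p_0$ as $x\to-\infty$ and $\phi(x)\to p_1$ as $x\to+\infty$,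 where $p_1$ is an equilibrium. Let $L_-\ge0$ be such that $\phi(-L_-)\in W^u_{loc}(p_0)$. Put $\mathcal M(x)=\nabla^2G(\varphi(x))$, $\mathcal M_-=\nabla^2G(\pi_1p_0)$ and $$\mathcal A_{-\infty}=\begin{pmatrix}0&D^{-1}\\-\mathcal M_-&0\end{pmatrix},\qquad \mathcal A_-(x)=\begin{pmatrix}0&0\\-\mathcal M(x)+\mathcal M_-&0\end{pmatrix}.$$ Let $Q$ be an invertible real matrix whose columns are eigenvectors of $\mathcal A_{-\infty}$, let $K_-=\|Q\|\,\|Q^{-1}\|$, and let $C_G$ be such that $\|D^3G(\pi_1\psi(z))\|\le C_G$ for all $z\in S$. For an eigenvalue $\nu$ of $\mathcal A_{-\infty}$ with eigenvector $V$, let $P^{cs}$ and $P^u$ be the complementary spectral projections of $\mathcal A_{-\infty}$ for the eigenvalues $\le\nu$ and $>\nu$, and on $X=L^\infty((-\infty,-L_-],\mathbb R^{2n})$ put $$\mathcal T_-(W)(x)=V+\int_{-\infty}^xe^{(\mathcal A_{-\infty}-\nu)(x-y)}P^{cs}\mathcal A_-(y)W(y)\,dy-\int_x^{-L_-}e^{(\mathcal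 A_{-\infty}-\nu)(x-y)}P^{u}\mathcal A_-(y)W(y)\,dy .$$ **Theorem.** Let $$\eta_M=\xi,\qquad C_M=C_G\,r_u\,\|A_0\|\sqrt{1+\vartheta^2}\;e^{\xi L_-},\qquad \lambda_{\mathcal T_-}=\frac{K_-C_M}{\eta_M}e^{-\eta_ML_-}.$$ Then - $\|\mathcal M(x)-\mathcal M_-\|\le C_Me^{-\eta_M|x|}$ and $\|\mathcal A_-(x)\|\le C_Me^{-\eta_M|x|}$ for all $x\le-L_-$; - for every eigenvalue $\nu$ of $\mathcal A_{-\infty}$ and every eigenvector $V$ for $\nu$, the integrals defining $\mathcal T_-$ converge, and $\mathcal T_-$ maps $X$ into $X$ and is Lipschitz with constant $\lambda_{\mathcal T_-}$ (hence a contraction if $\lambda_{\mathcal T_-}<1$); - $\lambda_{\mathcal T_-}\le\xi^{-1}K_-C_G\,r_u\,\|A_0\|\sqrt{1+\vartheta^2}$. -/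

import Mathlib

open Set Filter Topology MeasureTheory
open scoped Matrix ENNReal Matrix.Norms.L2Operator

noncomputable section

namespace StandingWave

/-- `ℝⁿ` with the Euclidean norm. -/
abbrev Conf (n : ℕ) : Type := EuclideanSpace ℝ (Fin n)

/-- `ℝ²ⁿ = ℝⁿ × ℝⁿ` with the Euclidean norm; the index `Sum.inl i` is the `i`-th coordinate of the
first factor and `Sum.inr i` the `i`-th coordinate of the second one. -/
abbrev Phase (n : ℕ) : Type := EuclideanSpace ℝ (Fin n ⊕ Fin n)

/-- Real `2n × 2n` matrices. Matrices carry the operator norm of the Euclidean norm throughout. -/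
abbrev Mat2 (n : ℕ) : Type := Matrix (Fin n ⊕ Fin n) (Fin n ⊕ Fin n) ℝ

variable {n : ℕ}

/-- Projection of `ℝ²ⁿ` onto its first factor (`π₁`, also `π_x`). -/
def fstPart (z : Phase n) : Conf n := WithLp.toLp 2 (fun i => z (Sum.inl i))

/-- Projection of `ℝ²ⁿ` onto its second factor (`π_y`). -/
def sndPart (z : Phase n) : Conf n := WithLp.toLp 2 (fun i => z (Sum.inr i))

/-- A matrix acting on `ℝ²ⁿ`. -/
def act (A : Mat2 n) (z : Phase n) : Phase n := Matrix.toEuclideanCLM (𝕜 := ℝ) A z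

/-! ### The Hamiltonian system -/

/-- `H(v, w) = ½ ⟨w, D⁻¹ w⟩ + G(v)` with `D = diag(d₁, …, dₙ)`. -/
def hamiltonian (d : Fin n → ℝ) (G : Conf n → ℝ) (q : Phase n) : ℝ :=
  (1 / 2) * ∑ i, (d i)⁻¹ * (q (Sum.inr i)) ^ 2 + G (fstPart q)

/-- The vector field `-J ∇H`, where `J = [[0, -I], [I, 0]]`. -/
def hamField (d : Fin n → ℝ) (G : Conf n → ℝ) (q : Phase n) : Phase n :=
  act (-(Matrix.J (Fin n) ℝ)) (gradient (hamiltonian d G) q)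

/-- `φ` is a solution on all of `ℝ` of the Hamiltonian system `q' = -J ∇H(q)` that connects the
equilibrium `p₀` (at `-∞`) to the equilibrium `p₁` (at `+∞`). -/
structure IsHeteroclinicOrbit (d : Fin n → ℝ) (G : Conf n → ℝ) (p₀ p₁ : Phase n)
    (φ : ℝ → Phase n) : Prop where
  equilibrium_left : hamField d G p₀ = 0
  equilibrium_right : hamField d G p₁ = 0
  solution : ∀ x : ℝ, HasDerivAt φ (hamField d G (φ x)) x
  limit_left : Tendsto φ atBot (𝓝 p₀)
  limit_right : Tendsto φ atTop (𝓝 p₁)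

/-! ### Linear change of coordinates at the equilibrium and the isolating box -/

/-- `ψ(z) = p₀ + A₀ z`. -/
def chart (p₀ : Phase n) (A₀ : Mat2 n) (z : Phase n) : Phase n := p₀ + act A₀ z

/-- The conjugate vector field `f(z) = -A₀⁻¹ J ∇H(ψ(z))`. -/
def conjField (d : Fin n → ℝ) (G : Conf n → ℝ) (p₀ : Phase n) (A₀ : Mat2 n) (z : Phase n) :
    Phase n :=
  act A₀⁻¹ (hamField d G (chart p₀ A₀ z))

/-- The box `S = B_u × B_s`, a product of closed Euclidean balls of radii `r_u` and `r_s`. -/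
def box (n : ℕ) (ru rs : ℝ) : Set (Phase n) := {z | ‖fstPart z‖ ≤ ru ∧ ‖sndPart z‖ ≤ rs}

/-- The Jacobian matrix of `f` at `z`. Its blocks are `π_x ∂f/∂x` (`toBlocks₁₁`),
`π_x ∂f/∂y` (`toBlocks₁₂`), `π_y ∂f/∂x` (`toBlocks₂₁`) and `π_y ∂f/∂y` (`toBlocks₂₂`). -/
def jac (f : Phase n → Phase n) (z : Phase n) : Mat2 n :=
  Matrix.of fun a b => (fderiv ℝ f z (EuclideanSpace.single b 1)) a

/-- The logarithmic norm: the largest eigenvalue of `(A + Aᵀ)/2`. -/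
def logNorm (A : Matrix (Fin n) (Fin n) ℝ) : ℝ :=
  sSup (spectrum ℝ ((1 / 2 : ℝ) • (A + Aᵀ)))

/-- The logarithmic minimum: the smallest eigenvalue of `(A + Aᵀ)/2`. -/
def logMin (A : Matrix (Fin n) (Fin n) ℝ) : ℝ :=
  sInf (spectrum ℝ ((1 / 2 : ℝ) • (A + Aᵀ)))

/-- The interval matrix hull of a matrix-valued function `F` on a set `S`: all matrices whose
`(i, j)` entry lies between the infimum and the supremum over `S` of the `(i, j)` entry of `F`. -/
def intervalHull (F : Phase n → Matrix (Fin n) (Fin n) ℝ) (S : Set (Phase n)) :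
    Set (Matrix (Fin n) (Fin n) ℝ) :=
  {A | ∀ i j, A i j ∈ Icc (sInf ((fun z => F z i j) '' S)) (sSup ((fun z => F z i j) '' S))}

/-- `μ = sup_{z ∈ S} ( l(π_y ∂f/∂y (z)) + ϑ⁻¹ ‖π_y ∂f/∂x (z)‖ )`. -/
def rateMu (f : Phase n → Phase n) (S : Set (Phase n)) (ϑ : ℝ) : ℝ :=
  sSup ((fun z => logNorm (jac f z).toBlocks₂₂ + (1 / ϑ) * ‖(jac f z).toBlocks₂₁‖) '' S)

/-- `ξ = inf { m_l(A) : A ∈ [π_x ∂f/∂x (S)] } - sup { ϑ ‖A'‖ : A' ∈ [π_x ∂f/∂y (S)] }`. -/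
def rateXi (f : Phase n → Phase n) (S : Set (Phase n)) (ϑ : ℝ) : ℝ :=
  sInf (logMin '' intervalHull (fun z => (jac f z).toBlocks₁₁) S)
    - sSup ((fun A' => ϑ * ‖A'‖) '' intervalHull (fun z => (jac f z).toBlocks₁₂) S)

/-- The local unstable manifold of `0` for `z' = f(z)` relative to `S`: the points with a backward
orbit that stays in `S` and converges to `0`. -/
def localUnstable (f : Phase n → Phase n) (S : Set (Phase n)) : Set (Phase n) :=
  {z | ∃ ζ : ℝ → Phase n, ζ 0 = z ∧
    (∀ t ≤ 0, HasDerivWithinAt ζ (f (ζ t)) (Iic 0) t) ∧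
    (∀ t ≤ 0, ζ t ∈ S) ∧ Tendsto ζ atBot (𝓝 0)}

/-- `W^u_loc(p₀)`: the local unstable manifold of `p₀` for the Hamiltonian system, that is, the
image under `ψ` of the local unstable manifold of `0` for the conjugate system. -/
def localUnstableAt (d : Fin n → ℝ) (G : Conf n → ℝ) (p₀ : Phase n) (A₀ : Mat2 n)
    (S : Set (Phase n)) : Set (Phase n) :=
  chart p₀ A₀ '' localUnstable (conjField d G p₀ A₀) S

/-! ### The linearization along the orbit -/

/-- The Hessian matrix `∇²G(v)`. -/
def hess (G : Conf n → ℝ) (v : Conf n) : Matrix (Fin n) (Fin n) ℝ :=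
  Matrix.of fun i j =>
    iteratedFDeriv ℝ 2 G v ![EuclideanSpace.single i 1, EuclideanSpace.single j 1]

/-- `𝓜(x) = ∇²G(φ(x))`, along the first component of an orbit in `ℝ²ⁿ`. -/
def potential (G : Conf n → ℝ) (φ : ℝ → Phase n) (x : ℝ) : Matrix (Fin n) (Fin n) ℝ :=
  hess G (fstPart (φ x))

/-- `𝓐₋∞ = [[0, D⁻¹], [-𝓜₋, 0]]`. -/
def asymMatrix (d : Fin n → ℝ) (Mm : Matrix (Fin n) (Fin n) ℝ) : Mat2 n :=
  Matrix.fromBlocks 0 (Matrix.diagonal fun i => (d i)⁻¹) (-Mm) 0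

/-- `𝓐₋(x) = [[0, 0], [-𝓜(x) + 𝓜₋, 0]]`. -/
def pertMatrix (M : ℝ → Matrix (Fin n) (Fin n) ℝ) (Mm : Matrix (Fin n) (Fin n) ℝ) (x : ℝ) :
    Mat2 n :=
  Matrix.fromBlocks 0 0 (-M x + Mm) 0

/-- `Q` is an invertible matrix whose columns are eigenvectors of `A`, the `j`-th column with
eigenvalue `ev j`; equivalently `A = Q diag(ev) Q⁻¹`. -/
def IsEigenvectorMatrix (A Q : Mat2 n) (ev : Fin n ⊕ Fin n → ℝ) : Prop :=
  IsUnit Q.det ∧ A * Q = Q * Matrix.diagonal ev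

/-- `K₋ = ‖Q‖ ‖Q⁻¹‖`. -/
def kMinus (Q : Mat2 n) : ℝ := ‖Q‖ * ‖Q⁻¹‖

/-- For `A = Q diag(ev) Q⁻¹`, the projection `P^{cs}` onto the sum of the eigenspaces of `A` with
eigenvalues `≤ ν`, along the sum of the remaining eigenspaces. -/
def projCS (Q : Mat2 n) (ev : Fin n ⊕ Fin n → ℝ) (ν : ℝ) : Mat2 n :=
  Q * Matrix.diagonal (fun j => if ev j ≤ ν then (1 : ℝ) else 0) * Q⁻¹

/-- The complementary projection `P^u`, onto the eigenspaces with eigenvalues `> ν`. -/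
def projU (Q : Mat2 n) (ev : Fin n ⊕ Fin n → ℝ) (ν : ℝ) : Mat2 n :=
  Q * Matrix.diagonal (fun j => if ν < ev j then (1 : ℝ) else 0) * Q⁻¹

/-- The integrand `e^{(A - ν)(x - y)} P B(y) W(y)`. -/
def kernelTerm (A P : Mat2 n) (ν : ℝ) (B : ℝ → Mat2 n) (W : ℝ → Phase n) (x y : ℝ) : Phase n :=
  act (NormedSpace.exp ((x - y) • (A - ν • (1 : Mat2 n))) * P * B y) (W y)

/-- The value at `x` of
`𝓣₋(W) = V + ∫_{-∞}^x e^{(A-ν)(x-y)} P^{cs} B(y) W(y) dy - ∫_x^{-L} e^{(A-ν)(x-y)} P^u B(y) W(y) dy`.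
-/
def tMinus (A Pcs Pu : Mat2 n) (ν : ℝ) (V : Phase n) (B : ℝ → Mat2 n) (L : ℝ)
    (W : ℝ → Phase n) (x : ℝ) : Phase n :=
  V + (∫ y in Iic x, kernelTerm A Pcs ν B W x y) - ∫ y in x..(-L), kernelTerm A Pu ν B W x y

/-- `X = L^∞((-∞, -L], ℝ²ⁿ)`. -/
abbrev XSpace (n : ℕ) (L : ℝ) : Type := Lp (Phase n) ∞ (volume.restrict (Iic (-L)))

/-- The integrals defining `𝓣₋` converge for all `W ∈ X` and `x ≤ -L`, and `𝓣₋` is a well defined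
map of `X` into itself that is Lipschitz with constant `lam`. -/
def TMinusLipschitz (A Pcs Pu : Mat2 n) (ν : ℝ) (V : Phase n) (B : ℝ → Mat2 n) (L lam : ℝ) :
    Prop :=
  (∀ W : XSpace n L, ∀ x ≤ -L,
    IntegrableOn (kernelTerm A Pcs ν B W x) (Iic x) ∧
    IntervalIntegrable (kernelTerm A Pu ν B W x) volume x (-L)) ∧
  ∃ T : XSpace n L → XSpace n L,
    (∀ W : XSpace n L, T W =ᵐ[volume.restrict (Iic (-L))] tMinus A Pcs Pu ν V B L W) ∧
    ∀ W₁ W₂ : XSpace n L, ‖T W₁ - T W₂‖ ≤ lam * ‖W₁ - W₂‖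

/-- `λ_{𝓣₋} = (K₋ C_M / η_M) e^{-η_M L₋}`. -/
def lambdaMinus (K CM ηM L : ℝ) : ℝ := K * CM / ηM * Real.exp (-ηM * L)

end StandingWave

end

open StandingWave

noncomputable section

namespace StandingWave

variable {n : ℕ}

/-! ### Matrices acting on Euclidean spaces -/

section Matrices

variable {ι : Type*} [Fintype ι] [DecidableEq ι]

/-! Write `f` for the conjugate field and `z = (x, y)`. Since `f 0 = 0`, the mean value theorem on
the segment from `0` to `z` turns bounds on the blocks of the Jacobian into two cone estimates: `⟨x,
π_x f⟩ ≥ ξ|x|²` where `|y| ≤ ϑ|x|` (`rateXi_mul_le_inner`), and `⟨y, π_y f⟩ ≤ μ|y|²` where `|y| ≥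
ϑ|x|` (`inner_le_rateMu_mul`). A backward orbit outside the cone `|y| ≤ ϑ|x|` would stay outside
with `|y|` never shrinking, so it could not tend to `0` (`backward_orbit_mem_cone`). Inside the
cone, `|x|` decays at least like `e^{ξt}` and controls `|y|` (`backward_orbit_norm_le`). ODE
uniqueness and the bound on `D³G` carry this decay over to the Hessian (`orbit_eq_chart`,
`norm_potential_sub_le`). For `𝓣₋`, diagonalization bounds both propagators by the condition number
of `Q`. The two integration ranges partition `(-∞, -L]`, so the Lipschitz constant is `K₋ C_M
∫_{-∞}^{-L} e^{ξy} dy` (`kernel_integrals_and_bound`). -/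

theorem norm_toEuclideanCLM_apply_le (A : Matrix ι ι ℝ) (x : EuclideanSpace ℝ ι) :
    ‖Matrix.toEuclideanCLM (𝕜 := ℝ) A x‖ ≤ ‖A‖ * ‖x‖ :=
  (Matrix.toEuclideanCLM (𝕜 := ℝ) A).le_opNorm x

theorem matrix_norm_le_of_apply {A : Matrix ι ι ℝ} {c : ℝ} (hc : 0 ≤ c)
    (h : ∀ x, ‖Matrix.toEuclideanCLM (𝕜 := ℝ) A x‖ ≤ c * ‖x‖) : ‖A‖ ≤ c :=
  (Matrix.toEuclideanCLM (𝕜 := ℝ) A).opNorm_le_bound hc h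

theorem matrix_norm_le_of_inner {A : Matrix ι ι ℝ} {c : ℝ} (hc : 0 ≤ c)
    (h : ∀ x y, inner ℝ x (Matrix.toEuclideanCLM (𝕜 := ℝ) A y) ≤ c * ‖x‖ * ‖y‖) : ‖A‖ ≤ c := by
  refine matrix_norm_le_of_apply hc fun y => ?_
  have h1 := h (Matrix.toEuclideanCLM (𝕜 := ℝ) A y) y
  rw [real_inner_self_eq_norm_sq] at h1
  rcases (norm_nonneg (Matrix.toEuclideanCLM (𝕜 := ℝ) A y)).eq_or_lt with h0 | h0
  · rw [← h0]; positivity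
  · exact le_of_mul_le_mul_left (by nlinarith) h0

theorem inner_toEuclideanCLM (A : Matrix ι ι ℝ) (x y : EuclideanSpace ℝ ι) :
    inner ℝ x (Matrix.toEuclideanCLM (𝕜 := ℝ) A y) = ∑ i, ∑ j, x i * A i j * y j := by
  simp only [PiLp.inner_apply, Matrix.ofLp_toEuclideanCLM, Matrix.mulVec, dotProduct,
    RCLike.inner_apply, conj_trivial, Finset.sum_mul]
  refine Finset.sum_congr rfl fun i _ => Finset.sum_congr rfl fun j _ => ?_
  ring

theorem inner_toEuclideanCLM_transpose (A : Matrix ι ι ℝ) (x y : EuclideanSpace ℝ ι) :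
    inner ℝ x (Matrix.toEuclideanCLM (𝕜 := ℝ) Aᵀ y)
      = inner ℝ y (Matrix.toEuclideanCLM (𝕜 := ℝ) A x) := by
  rw [inner_toEuclideanCLM, inner_toEuclideanCLM, Finset.sum_comm]
  refine Finset.sum_congr rfl fun i _ => Finset.sum_congr rfl fun j _ => ?_
  rw [Matrix.transpose_apply]; ring

/-- The antisymmetric part drops out of the quadratic form, so eigenvalues of the symmetric part
control the form of the full matrix. -/
theorem inner_symmPart (A : Matrix ι ι ℝ) (x : EuclideanSpace ℝ ι) :
    inner ℝ x (Matrix.toEuclideanCLM (𝕜 := ℝ) ((1 / 2 : ℝ) • (A + Aᵀ)) x)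
      = inner ℝ x (Matrix.toEuclideanCLM (𝕜 := ℝ) A x) := by
  simp only [map_smul, map_add, smul_apply, add_apply,
    inner_smul_right, inner_add_right, inner_toEuclideanCLM_transpose]
  ring

theorem isHermitian_symmPart {κ : Type*} (A : Matrix κ κ ℝ) : ((1 / 2 : ℝ) • (A + Aᵀ)).IsHermitian := by
  ext i j
  simp [add_comm, mul_add]

theorem norm_transpose_le (A : Matrix ι ι ℝ) : ‖Aᵀ‖ ≤ ‖A‖ := by
  refine matrix_norm_le_of_inner (norm_nonneg _) fun x y => ?_
  rw [inner_toEuclideanCLM_transpose]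
  calc _ ≤ ‖y‖ * ‖Matrix.toEuclideanCLM (𝕜 := ℝ) A x‖ := real_inner_le_norm _ _
    _ ≤ ‖y‖ * (‖A‖ * ‖x‖) := by gcongr; exact norm_toEuclideanCLM_apply_le A x
    _ = _ := by ring

theorem norm_symmPart_le (A : Matrix ι ι ℝ) : ‖(1 / 2 : ℝ) • (A + Aᵀ)‖ ≤ ‖A‖ := by
  rw [norm_smul]
  have h1 := norm_add_le A Aᵀ
  have h2 := norm_transpose_le A
  norm_num
  linarith

/-- In an orthonormal eigenbasis the form is diagonal; with Parseval, this yields the bounds by the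
extreme eigenvalues. -/
theorem inner_hermitian_eq_sum {A : Matrix ι ι ℝ} (hA : A.IsHermitian) (x : EuclideanSpace ℝ ι) :
    inner ℝ x (Matrix.toEuclideanCLM (𝕜 := ℝ) A x)
      = ∑ i, hA.eigenvalues i * ‖inner ℝ (hA.eigenvectorBasis i) x‖ ^ 2 := by
  rw [← hA.eigenvectorBasis.sum_inner_mul_inner]
  refine Finset.sum_congr rfl fun i _ => ?_
  have h1 : inner ℝ (hA.eigenvectorBasis i) (Matrix.toEuclideanCLM (𝕜 := ℝ) A x)
      = hA.eigenvalues i * inner ℝ (hA.eigenvectorBasis i) x := by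
    have hT : Aᵀ = A := by
      have := hA.eq
      rwa [Matrix.conjTranspose_eq_transpose_of_trivial] at this
    have h2 : Matrix.toEuclideanCLM (𝕜 := ℝ) A (hA.eigenvectorBasis i)
        = hA.eigenvalues i • hA.eigenvectorBasis i := by
      ext j
      have := congrFun (hA.mulVec_eigenvectorBasis i) j
      rw [Matrix.ofLp_toEuclideanCLM, this]
      rfl
    rw [← inner_toEuclideanCLM_transpose, hT, h2, inner_smul_right, real_inner_comm]
  rw [h1, Real.norm_eq_abs, sq_abs, real_inner_comm]
  ring

theorem spectrum_hermitian_finite {A : Matrix ι ι ℝ} (hA : A.IsHermitian) :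
    (spectrum ℝ A).Finite := by
  rw [hA.spectrum_real_eq_range_eigenvalues]
  exact Set.finite_range _

theorem inner_hermitian_le {A : Matrix ι ι ℝ} (hA : A.IsHermitian) (x : EuclideanSpace ℝ ι) :
    inner ℝ x (Matrix.toEuclideanCLM (𝕜 := ℝ) A x) ≤ sSup (spectrum ℝ A) * ‖x‖ ^ 2 := by
  rw [inner_hermitian_eq_sum hA, ← hA.eigenvectorBasis.sum_sq_norm_inner_right, Finset.mul_sum]
  gcongr with i
  exact le_csSup (spectrum_hermitian_finite hA).bddAbove (hA.eigenvalues_mem_spectrum_real i)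

theorem le_inner_hermitian {A : Matrix ι ι ℝ} (hA : A.IsHermitian) (x : EuclideanSpace ℝ ι) :
    sInf (spectrum ℝ A) * ‖x‖ ^ 2 ≤ inner ℝ x (Matrix.toEuclideanCLM (𝕜 := ℝ) A x) := by
  rw [inner_hermitian_eq_sum hA, ← hA.eigenvectorBasis.sum_sq_norm_inner_right, Finset.mul_sum]
  gcongr with i
  exact csInf_le (spectrum_hermitian_finite hA).bddBelow (hA.eigenvalues_mem_spectrum_real i)

theorem abs_le_norm_of_mem_spectrum {A : Matrix ι ι ℝ} (hA : A.IsHermitian) {k : ℝ}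
    (hk : k ∈ spectrum ℝ A) : |k| ≤ ‖A‖ := by
  -- A spectral point excludes the empty index type, for which the identity matrix has norm `0`
  -- instead of `1`.
  have : Nonempty ι := by
    rw [hA.spectrum_real_eq_range_eigenvalues] at hk
    obtain ⟨i, -⟩ := hk
    exact ⟨i⟩
  exact spectrum.norm_le_norm_of_mem hk

end Matrices

/-! ### Logarithmic norms -/

theorem inner_le_logNorm (A : Matrix (Fin n) (Fin n) ℝ) (x : Conf n) :
    inner ℝ x (Matrix.toEuclideanCLM (𝕜 := ℝ) A x) ≤ logNorm A * ‖x‖ ^ 2 := by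
  rw [← inner_symmPart]
  exact inner_hermitian_le (isHermitian_symmPart A) x

theorem logMin_le_inner (A : Matrix (Fin n) (Fin n) ℝ) (x : Conf n) :
    logMin A * ‖x‖ ^ 2 ≤ inner ℝ x (Matrix.toEuclideanCLM (𝕜 := ℝ) A x) := by
  rw [← inner_symmPart]
  exact le_inner_hermitian (isHermitian_symmPart A) x

/-- Together with `neg_norm_le_logMin`, this supplies the boundedness that makes the `sSup` and
`sInf` in `rateMu` and `rateXi` genuine bounds. -/
theorem logNorm_le_norm (A : Matrix (Fin n) (Fin n) ℝ) : logNorm A ≤ ‖A‖ :=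
  Real.sSup_le (fun _ hk => (le_abs_self _).trans
    ((abs_le_norm_of_mem_spectrum (isHermitian_symmPart A) hk).trans (norm_symmPart_le A)))
    (norm_nonneg A)

theorem neg_norm_le_logMin (A : Matrix (Fin n) (Fin n) ℝ) : -‖A‖ ≤ logMin A := by
  rcases (spectrum ℝ ((1 / 2 : ℝ) • (A + Aᵀ))).eq_empty_or_nonempty with h | h
  -- An empty spectrum gives `logMin` the default value `0`.
  · rw [logMin, h, Real.sInf_empty]
    exact neg_nonpos.2 (norm_nonneg A)
  · refine le_csInf h fun k hk => ?_
    have h1 := (abs_le_norm_of_mem_spectrum (isHermitian_symmPart A) hk).trans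
      (norm_symmPart_le A)
    exact (abs_le.1 h1).1

/-- The hull is a product of compact intervals, and the operator norm is continuous for the
entrywise topology. -/
theorem exists_norm_le_of_mem_intervalHull (F : Phase n → Matrix (Fin n) (Fin n) ℝ)
    (S : Set (Phase n)) : ∃ C, ∀ A ∈ intervalHull F S, ‖A‖ ≤ C := by
  have hc : IsCompact (Set.pi univ fun i => Set.pi univ fun j =>
      Icc (sInf ((fun z => F z i j) '' S)) (sSup ((fun z => F z i j) '' S)) :
      Set (Fin n → Fin n → ℝ)) :=
    isCompact_univ_pi fun i => isCompact_univ_pi fun j => isCompact_Icc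
  have hcont : Continuous fun A : Matrix (Fin n) (Fin n) ℝ => A := continuous_id
  obtain ⟨C, hC⟩ := IsCompact.exists_bound_of_continuousOn
    (E := Matrix (Fin n) (Fin n) ℝ) hc hcont.continuousOn
  exact ⟨C, fun A hA => hC A fun i _ j _ => hA i j⟩

theorem mem_intervalHull {F : Phase n → Matrix (Fin n) (Fin n) ℝ} {S : Set (Phase n)}
    (hS : IsCompact S) (hF : Continuous F) {z : Phase n} (hz : z ∈ S) :
    F z ∈ intervalHull F S := by
  intro i j
  have hc : IsCompact ((fun z => F z i j) '' S) :=
    hS.image (hF.matrix_elem i j)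
  exact ⟨csInf_le hc.bddBelow ⟨z, hz, rfl⟩, le_csSup hc.bddAbove ⟨z, hz, rfl⟩⟩

/-! ### The two factors of the phase space -/

/-- `fstPart` as a continuous linear map. -/
def fstL (n : ℕ) : Phase n →L[ℝ] Conf n :=
  LinearMap.toContinuousLinearMap
    { toFun := fstPart
      map_add' := fun _ _ => rfl
      map_smul' := fun _ _ => rfl }

/-- `sndPart` as a continuous linear map. -/
def sndL (n : ℕ) : Phase n →L[ℝ] Conf n :=
  LinearMap.toContinuousLinearMap
    { toFun := sndPart
      map_add' := fun _ _ => rfl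
      map_smul' := fun _ _ => rfl }

@[simp] theorem fstL_apply (z : Phase n) : fstL n z = fstPart z := rfl

@[simp] theorem sndL_apply (z : Phase n) : sndL n z = sndPart z := rfl

theorem norm_sq_eq_add (z : Phase n) : ‖z‖ ^ 2 = ‖fstPart z‖ ^ 2 + ‖sndPart z‖ ^ 2 := by
  simp only [EuclideanSpace.norm_sq_eq, Fintype.sum_sum_type]
  rfl

theorem norm_fstPart_le (z : Phase n) : ‖fstPart z‖ ≤ ‖z‖ := by
  have h := norm_sq_eq_add z
  exact le_of_sq_le_sq (by nlinarith [sq_nonneg ‖sndPart z‖]) (norm_nonneg z)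

theorem fstPart_act (A : Mat2 n) (z : Phase n) :
    fstPart (act A z) = Matrix.toEuclideanCLM (𝕜 := ℝ) A.toBlocks₁₁ (fstPart z)
      + Matrix.toEuclideanCLM (𝕜 := ℝ) A.toBlocks₁₂ (sndPart z) := by
  ext i
  simp only [fstPart, sndPart, act, Matrix.ofLp_toEuclideanCLM, PiLp.add_apply, Matrix.mulVec,
    dotProduct, Fintype.sum_sum_type]
  rfl

theorem sndPart_act (A : Mat2 n) (z : Phase n) :
    sndPart (act A z) = Matrix.toEuclideanCLM (𝕜 := ℝ) A.toBlocks₂₁ (fstPart z)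
      + Matrix.toEuclideanCLM (𝕜 := ℝ) A.toBlocks₂₂ (sndPart z) := by
  ext i
  simp only [fstPart, sndPart, act, Matrix.ofLp_toEuclideanCLM, PiLp.add_apply, Matrix.mulVec,
    dotProduct, Fintype.sum_sum_type]
  rfl

theorem norm_act_le (A : Mat2 n) (z : Phase n) : ‖act A z‖ ≤ ‖A‖ * ‖z‖ :=
  norm_toEuclideanCLM_apply_le A z

theorem act_jac {f : Phase n → Phase n} (z v : Phase n) : act (jac f z) v = fderiv ℝ f z v := by
  have hv : v = ∑ b, v b • EuclideanSpace.single b (1 : ℝ) := by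
    conv_lhs => rw [← (EuclideanSpace.basisFun (Fin n ⊕ Fin n) ℝ).sum_repr v]
    simp
  ext a
  conv_rhs => rw [hv, map_sum]
  simp only [act, Matrix.ofLp_toEuclideanCLM, Matrix.mulVec, dotProduct, jac, Matrix.of_apply,
    map_smul, WithLp.ofLp_sum, WithLp.ofLp_smul, Finset.sum_apply, Pi.smul_apply, smul_eq_mul]
  exact Finset.sum_congr rfl fun b _ => mul_comm _ _

theorem norm_fromBlocks_lower_left_le (X : Matrix (Fin n) (Fin n) ℝ) :
    ‖(Matrix.fromBlocks 0 0 X 0 : Mat2 n)‖ ≤ ‖X‖ := by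
  refine matrix_norm_le_of_apply (norm_nonneg X) fun z => ?_
  have h1 : fstPart (act (Matrix.fromBlocks 0 0 X 0) z) = 0 := by
    rw [fstPart_act]; simp
  have h2 : sndPart (act (Matrix.fromBlocks 0 0 X 0) z)
      = Matrix.toEuclideanCLM (𝕜 := ℝ) X (fstPart z) := by
    rw [sndPart_act]; simp
  have h3 := norm_sq_eq_add (act (Matrix.fromBlocks 0 0 X 0) z)
  rw [h1, h2, norm_zero] at h3
  have h4 : ‖act (Matrix.fromBlocks 0 0 X 0) z‖ ≤ ‖Matrix.toEuclideanCLM (𝕜 := ℝ) X (fstPart z)‖ :=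
    le_of_sq_le_sq (by linarith) (norm_nonneg _)
  calc _ ≤ ‖Matrix.toEuclideanCLM (𝕜 := ℝ) X (fstPart z)‖ := h4
    _ ≤ ‖X‖ * ‖fstPart z‖ := norm_toEuclideanCLM_apply_le X _
    _ ≤ ‖X‖ * ‖z‖ := by gcongr; exact norm_fstPart_le z

/-! ### The box -/

theorem isCompact_box (n : ℕ) (ru rs : ℝ) : IsCompact (box n ru rs) := by
  refine Metric.isCompact_of_isClosed_isBounded ?_ ?_
  · exact (isClosed_le (fstL n).continuous.norm continuous_const).inter
      (isClosed_le (sndL n).continuous.norm continuous_const)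
  · refine isBounded_iff_forall_norm_le.2 ⟨√(ru ^ 2 + rs ^ 2), fun z hz => ?_⟩
    refine Real.le_sqrt_of_sq_le ?_
    rw [norm_sq_eq_add]
    gcongr
    exacts [hz.1, hz.2]

theorem zero_mem_box {ru rs : ℝ} (hru : 0 ≤ ru) (hrs : 0 ≤ rs) : (0 : Phase n) ∈ box n ru rs := by
  constructor
  · rw [← fstL_apply, map_zero, norm_zero]; exact hru
  · rw [← sndL_apply, map_zero, norm_zero]; exact hrs

theorem convex_box (n : ℕ) (ru rs : ℝ) : Convex ℝ (box n ru rs) := by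
  have h1 : Convex ℝ {z : Phase n | ‖fstPart z‖ ≤ ru} := by
    have h := (convex_closedBall (0 : Conf n) ru).linear_preimage (fstL n).toLinearMap
    exact fun x hx y hy a b ha hb hab => by
      simpa using h (x := x) (by simpa using hx) (y := y) (by simpa using hy) ha hb hab
  have h2 : Convex ℝ {z : Phase n | ‖sndPart z‖ ≤ rs} := by
    have h := (convex_closedBall (0 : Conf n) rs).linear_preimage (sndL n).toLinearMap
    exact fun x hx y hy a b ha hb hab => by
      simpa using h (x := x) (by simpa using hx) (y := y) (by simpa using hy) ha hb hab
  exact h1.inter h2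

theorem smul_mem_box {ru rs : ℝ} {z : Phase n} (hz : z ∈ box n ru rs) {s : ℝ}
    (hs : s ∈ Icc (0 : ℝ) 1) : s • z ∈ box n ru rs :=
  (convex_box n ru rs).smul_mem_of_zero_mem
    (zero_mem_box ((norm_nonneg _).trans hz.1) ((norm_nonneg _).trans hz.2)) hz hs

/-! ### Cone estimates for a vector field vanishing at the origin -/

section Field

variable {f : Phase n → Phase n}

theorem continuous_jac (hf : ContDiff ℝ 1 f) : Continuous (jac f) := by
  refine continuous_matrix fun a b => ?_
  have h := (hf.continuous_fderiv one_ne_zero).clm_apply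
    (continuous_const (y := EuclideanSpace.single b (1 : ℝ)))
  exact (EuclideanSpace.proj a : Phase n →L[ℝ] ℝ).continuous.comp h

/-- Mean value theorem along the segment from `0` to `z`, tested against a linear functional. -/
theorem exists_eq_fderiv_smul (hf : ContDiff ℝ 1 f) (h0 : f 0 = 0) (ℓ : Phase n →L[ℝ] ℝ)
    (z : Phase n) : ∃ s ∈ Icc (0 : ℝ) 1, ℓ (f z) = ℓ (act (jac f (s • z)) z) := by
  have hd : ∀ s : ℝ, HasDerivAt (fun s : ℝ => ℓ (f (s • z))) (ℓ (fderiv ℝ f (s • z) z)) s := by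
    intro s
    have h1 : HasDerivAt (fun s : ℝ => s • z) z s := by
      simpa using (hasDerivAt_id s).smul_const z
    have h2 := (hf.differentiable one_ne_zero (s • z)).hasFDerivAt.comp_hasDerivAt s h1
    exact ℓ.hasFDerivAt.comp_hasDerivAt s h2
  obtain ⟨s, hs, h⟩ := exists_hasDerivAt_eq_slope _ _ zero_lt_one
    (fun s _ => (hd s).continuousAt.continuousWithinAt) fun s _ => hd s
  refine ⟨s, Ioo_subset_Icc_self hs, ?_⟩
  rw [act_jac, h]
  simp [h0]

variable {ru rs ϑ : ℝ}

/-- The diagonal block contributes at least `m_l |x|²`. By the cone condition the coupling block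
loses at most `ϑ‖·‖ |x|²`. Both blocks lie in their interval hulls. -/
theorem rateXi_mul_le_inner (hf : ContDiff ℝ 1 f) (h0 : f 0 = 0) (hϑ : 0 < ϑ) {z : Phase n}
    (hz : z ∈ box n ru rs) (hc : ‖sndPart z‖ ≤ ϑ * ‖fstPart z‖) :
    rateXi f (box n ru rs) ϑ * ‖fstPart z‖ ^ 2 ≤ inner ℝ (fstPart z) (fstPart (f z)) := by
  obtain ⟨s, hs, h⟩ := exists_eq_fderiv_smul hf h0 ((innerSL ℝ (fstPart z)).comp (fstL n)) z
  simp only [ContinuousLinearMap.comp_apply, innerSL_apply_apply, fstL_apply] at h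
  rw [h, fstPart_act, inner_add_right]
  have hsz := smul_mem_box hz hs
  have hJ := continuous_jac hf
  have h11 : (jac f (s • z)).toBlocks₁₁ ∈
      intervalHull (fun z => (jac f z).toBlocks₁₁) (box n ru rs) :=
    mem_intervalHull (isCompact_box n ru rs)
      (continuous_matrix fun i j => hJ.matrix_elem _ _) hsz
  have h12 : (jac f (s • z)).toBlocks₁₂ ∈
      intervalHull (fun z => (jac f z).toBlocks₁₂) (box n ru rs) :=
    mem_intervalHull (isCompact_box n ru rs)
      (continuous_matrix fun i j => hJ.matrix_elem _ _) hsz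
  obtain ⟨C₁, hC₁⟩ := exists_norm_le_of_mem_intervalHull
    (fun z => (jac f z).toBlocks₁₁) (box n ru rs)
  obtain ⟨C₂, hC₂⟩ := exists_norm_le_of_mem_intervalHull
    (fun z => (jac f z).toBlocks₁₂) (box n ru rs)
  have b1 : sInf (logMin '' intervalHull (fun z => (jac f z).toBlocks₁₁) (box n ru rs))
      ≤ logMin (jac f (s • z)).toBlocks₁₁ := by
    refine csInf_le ⟨-C₁, ?_⟩ ⟨_, h11, rfl⟩
    rintro _ ⟨A, hA, rfl⟩
    exact (neg_le_neg (hC₁ A hA)).trans (neg_norm_le_logMin A)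
  have b2 : ϑ * ‖(jac f (s • z)).toBlocks₁₂‖
      ≤ sSup ((fun A' => ϑ * ‖A'‖) '' intervalHull (fun z => (jac f z).toBlocks₁₂) (box n ru rs)) := by
    refine le_csSup ⟨ϑ * C₂, ?_⟩ ⟨_, h12, rfl⟩
    rintro _ ⟨A, hA, rfl⟩
    exact mul_le_mul_of_nonneg_left (hC₂ A hA) hϑ.le
  have e1 := logMin_le_inner (jac f (s • z)).toBlocks₁₁ (fstPart z)
  have e2 : -(ϑ * ‖(jac f (s • z)).toBlocks₁₂‖ * ‖fstPart z‖ ^ 2)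
      ≤ inner ℝ (fstPart z)
        (Matrix.toEuclideanCLM (𝕜 := ℝ) (jac f (s • z)).toBlocks₁₂ (sndPart z)) := by
    refine (abs_le.1 ((abs_real_inner_le_norm _ _).trans ?_)).1
    calc _ ≤ ‖fstPart z‖ * (‖(jac f (s • z)).toBlocks₁₂‖ * (ϑ * ‖fstPart z‖)) := by
          gcongr
          exact (norm_toEuclideanCLM_apply_le _ _).trans (by gcongr)
      _ = _ := by ring
  have e3 := mul_le_mul_of_nonneg_right (sub_le_sub b1 b2) (sq_nonneg ‖fstPart z‖)
  unfold rateXi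
  linarith [sub_mul (logMin (jac f (s • z)).toBlocks₁₁) (ϑ * ‖(jac f (s • z)).toBlocks₁₂‖)
    (‖fstPart z‖ ^ 2)]

/-- Here `|x| ≤ |y|/ϑ` absorbs the coupling. The mean value point is common to both blocks, so a
supremum over points suffices and no hull is needed. -/
theorem inner_le_rateMu_mul (hf : ContDiff ℝ 1 f) (h0 : f 0 = 0) (hϑ : 0 < ϑ) {z : Phase n}
    (hz : z ∈ box n ru rs) (hc : ϑ * ‖fstPart z‖ ≤ ‖sndPart z‖) :
    inner ℝ (sndPart z) (sndPart (f z)) ≤ rateMu f (box n ru rs) ϑ * ‖sndPart z‖ ^ 2 := by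
  obtain ⟨s, hs, h⟩ := exists_eq_fderiv_smul hf h0 ((innerSL ℝ (sndPart z)).comp (sndL n)) z
  simp only [ContinuousLinearMap.comp_apply, innerSL_apply_apply, sndL_apply] at h
  rw [h, sndPart_act, inner_add_right]
  have hsz := smul_mem_box hz hs
  have hJ := continuous_jac hf
  have h21 : Continuous fun z => (jac f z).toBlocks₂₁ :=
    continuous_matrix fun i j => hJ.matrix_elem _ _
  have h22 : Continuous fun z => (jac f z).toBlocks₂₂ :=
    continuous_matrix fun i j => hJ.matrix_elem _ _
  have b : logNorm (jac f (s • z)).toBlocks₂₂ + (1 / ϑ) * ‖(jac f (s • z)).toBlocks₂₁‖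
      ≤ rateMu f (box n ru rs) ϑ := by
    -- A continuous majorant on the compact box bounds the set above without continuity of
    -- `logNorm`.
    have hcont : Continuous fun z => ‖(jac f z).toBlocks₂₂‖ + (1 / ϑ) * ‖(jac f z).toBlocks₂₁‖ :=
      h22.norm.add (continuous_const.mul h21.norm)
    obtain ⟨C, hC⟩ := ((isCompact_box n ru rs).image hcont).bddAbove
    refine le_csSup ⟨C, ?_⟩ ⟨_, hsz, rfl⟩
    rintro _ ⟨w, hw, rfl⟩
    exact (add_le_add_left (logNorm_le_norm _) _).trans (hC ⟨w, hw, rfl⟩)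
  have e1 := inner_le_logNorm (jac f (s • z)).toBlocks₂₂ (sndPart z)
  have e2 : inner ℝ (sndPart z)
        (Matrix.toEuclideanCLM (𝕜 := ℝ) (jac f (s • z)).toBlocks₂₁ (fstPart z))
      ≤ (1 / ϑ) * ‖(jac f (s • z)).toBlocks₂₁‖ * ‖sndPart z‖ ^ 2 := by
    have hc' : ‖fstPart z‖ ≤ (1 / ϑ) * ‖sndPart z‖ := by
      rw [one_div, ← div_eq_inv_mul, le_div_iff₀ hϑ, mul_comm]; exact hc
    refine (real_inner_le_norm _ _).trans ?_
    calc _ ≤ ‖sndPart z‖ * (‖(jac f (s • z)).toBlocks₂₁‖ * ((1 / ϑ) * ‖sndPart z‖)) := by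
          gcongr
          exact (norm_toEuclideanCLM_apply_le _ _).trans (by gcongr)
      _ = _ := by ring
  have e3 := mul_le_mul_of_nonneg_right b (sq_nonneg ‖sndPart z‖)
  rw [add_mul] at e3
  linarith

/-! ### Backward orbits in the box -/

theorem exists_lipschitzOnWith_closedBall (hf : ContDiff ℝ 1 f) (R : ℝ) :
    ∃ K, LipschitzOnWith K f (Metric.closedBall 0 R) :=
  hf.locallyLipschitz.locallyLipschitzOn.exists_lipschitzOnWith_of_compact
    (isCompact_closedBall 0 R)

variable {ζ : ℝ → Phase n}

theorem hasDerivAt_norm_sq_comp {g : ℝ → Phase n} {g' : Phase n} {t : ℝ} {s : Set ℝ}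
    (hg : HasDerivWithinAt g g' s t) (P : Phase n →L[ℝ] Conf n) :
    HasDerivWithinAt (fun t => ‖P (g t)‖ ^ 2) (2 * inner ℝ (P (g t)) (P g')) s t :=
  (P.hasFDerivAt.comp_hasDerivWithinAt t hg).norm_sq

/-- A backward orbit that is nonzero at time `0` never vanishes. -/
theorem backward_orbit_ne_zero (hf : ContDiff ℝ 1 f) (h0 : f 0 = 0)
    (hζ : ∀ t ≤ 0, HasDerivWithinAt ζ (f (ζ t)) (Iic 0) t) {t₀ t : ℝ} (ht₀ : t₀ ≤ 0)
    (ht : t ≤ t₀) (hne : ζ t₀ ≠ 0) : ζ t ≠ 0 := by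
  intro hz
  have hcont : ContinuousOn ζ (Icc t t₀) := fun u hu =>
    (hζ u (hu.2.trans ht₀)).continuousWithinAt.mono fun v hv => hv.2.trans ht₀
  obtain ⟨R, hR⟩ := isCompact_Icc.exists_bound_of_continuousOn hcont
  obtain ⟨K, hK⟩ := exists_lipschitzOnWith_closedBall hf R
  have hR0 : 0 ≤ R := (norm_nonneg _).trans (hR t ⟨le_rfl, ht⟩)
  -- A zero at `t` would force agreement with the zero solution on `[t, t₀]`, as `f` is Lipschitz on
  -- a ball containing both.
  refine hne (ODE_solution_unique_of_mem_Icc_right (v := fun _ => f)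
    (s := fun _ => Metric.closedBall 0 R) (fun _ _ => hK) hcont (fun u hu => ?_)
    (fun u hu => by simpa using hR u (Ico_subset_Icc_self hu)) (g := fun _ => 0)
    continuousOn_const (fun u hu => by simpa [h0] using hasDerivWithinAt_const u (Ici u) (0 : Phase n))
    (fun u hu => by simpa using hR0) hz ⟨ht, le_rfl⟩)
  have hu : u < 0 := hu.2.trans_le ht₀
  exact ((hζ u hu.le).hasDerivAt (Iic_mem_nhds hu)).hasDerivWithinAt

/-- A backward orbit in the box that converges to `0` lies in the cone `|y| ≤ ϑ |x|`. -/
theorem backward_orbit_mem_cone (hf : ContDiff ℝ 1 f) (h0 : f 0 = 0) (hϑ : 0 < ϑ)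
    (hμ : rateMu f (box n ru rs) ϑ < 0) (hξ : 0 < rateXi f (box n ru rs) ϑ)
    (hζ : ∀ t ≤ 0, HasDerivWithinAt ζ (f (ζ t)) (Iic 0) t)
    (hbox : ∀ t ≤ 0, ζ t ∈ box n ru rs) (hlim : Tendsto ζ atBot (𝓝 0)) {t₀ : ℝ} (ht₀ : t₀ ≤ 0) :
    ‖sndPart (ζ t₀)‖ ≤ ϑ * ‖fstPart (ζ t₀)‖ := by
  by_contra! hlt
  have hy0 : 0 < ‖sndPart (ζ t₀)‖ := lt_of_le_of_lt (by positivity) hlt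
  have hne : ζ t₀ ≠ 0 := by
    rintro h
    rw [h, ← sndL_apply, map_zero, norm_zero] at hy0
    exact lt_irrefl _ hy0
  -- Time is reversed from `t₀`, so that forward barrier and monotonicity arguments apply.
  have hrev : ∀ s : ℝ, 0 ≤ s → HasDerivWithinAt (fun s => ζ (t₀ - s)) (-f (ζ (t₀ - s))) (Ici 0) s := by
    intro s hs
    have h1 : HasDerivWithinAt (fun s : ℝ => t₀ - s) (-1) (Ici 0) s := by
      simpa using ((hasDerivAt_id s).const_sub t₀).hasDerivWithinAt
    have h2 := HasDerivWithinAt.scomp s (hζ (t₀ - s) (by linarith)) h1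
      (fun u hu => by simp only [mem_Iic]; linarith [mem_Ici.1 hu])
    rw [neg_one_smul] at h2
    exact h2
  have hx' := fun s hs => hasDerivAt_norm_sq_comp (hrev s hs) (fstL n)
  have hy' := fun s hs => hasDerivAt_norm_sq_comp (hrev s hs) (sndL n)
  simp only [fstL_apply, sndL_apply] at hx' hy'
  have hxn : ∀ w : Phase n, fstPart (-w) = -fstPart w := fun w => (fstL n).map_neg w
  have hyn : ∀ w : Phase n, sndPart (-w) = -sndPart w := fun w => (sndL n).map_neg w
  simp only [hxn, hyn, inner_neg_right] at hx' hy'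
  have hout : ∀ s : ℝ, 0 ≤ s → ϑ * ‖fstPart (ζ (t₀ - s))‖ ≤ ‖sndPart (ζ (t₀ - s))‖ := by
    intro T hT
    have hder := fun s hs => ((hx' s hs).const_mul (ϑ ^ 2)).sub (hy' s hs)
    -- Barrier argument: `ϑ²|x|² - |y|²` starts negative and cannot become positive, because its
    -- derivative is strictly negative wherever it vanishes.
    have key := image_le_of_deriv_right_lt_deriv_boundary (a := 0) (b := T)
      (f := fun s => ϑ ^ 2 * ‖fstPart (ζ (t₀ - s))‖ ^ 2 - ‖sndPart (ζ (t₀ - s))‖ ^ 2)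
      (fun s hs => (hder s hs.1).continuousWithinAt.mono fun u hu => hu.1)
      (fun s hs => (hder s hs.1).mono (Ici_subset_Ici.2 hs.1))
      (B := fun _ => 0) (B' := fun _ => 0) ?_ (fun x => hasDerivAt_const x 0) ?_ ⟨hT, le_rfl⟩
    · refine le_of_sq_le_sq ?_ (norm_nonneg _)
      rw [mul_pow]; linarith
    · have h2 : (ϑ * ‖fstPart (ζ t₀)‖) ^ 2 ≤ ‖sndPart (ζ t₀)‖ ^ 2 := by gcongr
      simp only [sub_zero]
      rw [mul_pow] at h2; linarith
    · intro s hs heq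
      set z := ζ (t₀ - s) with hzdef
      have hzb : z ∈ box n ru rs := hbox _ (by linarith [hs.1])
      have hzne : z ≠ 0 := backward_orbit_ne_zero hf h0 hζ ht₀ (by linarith [hs.1]) hne
      have heq' : ‖sndPart z‖ ^ 2 = (ϑ * ‖fstPart z‖) ^ 2 := by rw [mul_pow]; linarith
      have heq2 : ‖sndPart z‖ = ϑ * ‖fstPart z‖ :=
        (sq_eq_sq₀ (norm_nonneg _) (by positivity)).1 heq'
      have e1 := rateXi_mul_le_inner hf h0 hϑ hzb heq2.le
      have e2 := inner_le_rateMu_mul hf h0 hϑ hzb heq2.ge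
      have hypos : 0 < ‖sndPart z‖ := by
        refine lt_of_le_of_ne (norm_nonneg _) fun hy => hzne ?_
        have hx : ‖fstPart z‖ = 0 := by
          rw [← hy] at heq2
          exact (mul_eq_zero.1 heq2.symm).resolve_left hϑ.ne'
        have := norm_sq_eq_add z
        rw [hx, ← hy] at this
        simpa using this
      -- On the boundary of the cone both estimates hold. Strictness comes from `μ < 0` and `y ≠ 0`,
      -- the latter because the orbit never vanishes.
      have e3 : rateMu f (box n ru rs) ϑ * ‖sndPart z‖ ^ 2 < 0 :=
        mul_neg_of_neg_of_pos hμ (by positivity)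
      have e4 : 0 ≤ ϑ ^ 2 * inner ℝ (fstPart z) (fstPart (f z)) :=
        mul_nonneg (sq_nonneg _) (le_trans (by positivity) e1)
      linarith
  -- Outside the cone `|y|²` is nondecreasing in reversed time, yet it starts positive and must tend
  -- to `0`.
  have hmono : MonotoneOn (fun s => ‖sndPart (ζ (t₀ - s))‖ ^ 2) (Ici 0) := by
    refine monotoneOn_of_hasDerivWithinAt_nonneg (convex_Ici 0)
      (fun s hs => (hy' s hs).continuousWithinAt)
      (fun s hs => (hy' s (interior_subset hs)).mono interior_subset) fun s hs => ?_
    have hs0 : 0 ≤ s := interior_subset hs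
    have := inner_le_rateMu_mul hf h0 hϑ (hbox (t₀ - s) (by linarith)) (hout s hs0)
    nlinarith [sq_nonneg ‖sndPart (ζ (t₀ - s))‖]
  have hto : Tendsto (fun s : ℝ => ‖sndPart (ζ (t₀ - s))‖ ^ 2) atTop (𝓝 0) := by
    have h1 : Tendsto (fun s : ℝ => t₀ - s) atTop atBot :=
      tendsto_atBot_add_const_left atTop t₀ tendsto_neg_atTop_atBot
    have h2 := (((sndL n).continuous.tendsto 0).comp (hlim.comp h1)).norm.pow 2
    rw [map_zero, norm_zero, zero_pow two_ne_zero] at h2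
    exact h2
  have h3 : ‖sndPart (ζ t₀)‖ ^ 2 ≤ 0 := by
    refine ge_of_tendsto hto ((eventually_ge_atTop 0).mono fun s hs => ?_)
    simpa using hmono self_mem_Ici hs hs
  nlinarith

/-- Exponential decay of a backward orbit in the box that converges to `0`. -/
theorem backward_orbit_norm_le (hf : ContDiff ℝ 1 f) (h0 : f 0 = 0) (hϑ : 0 < ϑ)
    (hμ : rateMu f (box n ru rs) ϑ < 0) (hξ : 0 < rateXi f (box n ru rs) ϑ)
    (hζ : ∀ t ≤ 0, HasDerivWithinAt ζ (f (ζ t)) (Iic 0) t)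
    (hbox : ∀ t ≤ 0, ζ t ∈ box n ru rs) (hlim : Tendsto ζ atBot (𝓝 0)) {t : ℝ} (ht : t ≤ 0) :
    ‖ζ t‖ ≤ ru * √(1 + ϑ ^ 2) * Real.exp (rateXi f (box n ru rs) ϑ * t) := by
  set ξ := rateXi f (box n ru rs) ϑ with hξdef
  have hcone := fun t ht =>
    backward_orbit_mem_cone hf h0 hϑ hμ hξ hζ hbox hlim (t₀ := t) ht
  have hder : ∀ t ≤ 0, HasDerivWithinAt
      (fun t => Real.exp (-(2 * ξ) * t) * ‖fstPart (ζ t)‖ ^ 2)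
      (Real.exp (-(2 * ξ) * t) * (-(2 * ξ)) * ‖fstPart (ζ t)‖ ^ 2 +
        Real.exp (-(2 * ξ) * t) * (2 * inner ℝ (fstPart (ζ t)) (fstPart (f (ζ t)))))
      (Iic 0) t := by
    intro t ht
    have h1 : HasDerivAt (fun t : ℝ => Real.exp (-(2 * ξ) * t))
        (Real.exp (-(2 * ξ) * t) * (-(2 * ξ))) t := by
      simpa using ((hasDerivAt_id t).const_mul (-(2 * ξ))).exp
    exact h1.hasDerivWithinAt.mul (hasDerivAt_norm_sq_comp (hζ t ht) (fstL n))
  -- The weight cancels the growth rate `2ξ` of `|x|²`; comparing `t` with `0`, where `|x| ≤ ru`,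
  -- gives the decay.
  have hmono : MonotoneOn (fun t => Real.exp (-(2 * ξ) * t) * ‖fstPart (ζ t)‖ ^ 2) (Iic 0) := by
    refine monotoneOn_of_hasDerivWithinAt_nonneg (convex_Iic 0)
      (fun s hs => (hder s hs).continuousWithinAt)
      (fun s hs => (hder s (mem_Iic.1 (interior_subset hs))).mono interior_subset) fun s hs => ?_
    have hs0 : s ≤ 0 := mem_Iic.1 (interior_subset hs)
    have h1 := rateXi_mul_le_inner hf h0 hϑ (hbox s hs0) (hcone s hs0)
    have h2 := mul_nonneg (Real.exp_nonneg (-(2 * ξ) * s)) (sub_nonneg.2 h1)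
    linarith
  have h1 := hmono ht self_mem_Iic ht
  simp only [mul_zero, Real.exp_zero, one_mul] at h1
  have h2 : ‖fstPart (ζ 0)‖ ≤ ru := (hbox 0 le_rfl).1
  have hru : 0 ≤ ru := (norm_nonneg _).trans h2
  have h3 : ‖fstPart (ζ t)‖ ^ 2 ≤ ru ^ 2 * Real.exp (ξ * t) ^ 2 := by
    have h4 : ‖fstPart (ζ 0)‖ ^ 2 ≤ ru ^ 2 := by gcongr
    have h5 : Real.exp (ξ * t) ^ 2 * Real.exp (-(2 * ξ) * t) = 1 := by
      rw [← Real.exp_nat_mul, ← Real.exp_add]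
      simp only [Nat.cast_ofNat, Real.exp_eq_one_iff]; ring
    have h6 := mul_le_mul_of_nonneg_left (h1.trans h4) (sq_nonneg (Real.exp (ξ * t)))
    rw [← mul_assoc, h5, one_mul] at h6
    linarith
  have h4 : ‖sndPart (ζ t)‖ ^ 2 ≤ (ϑ * ‖fstPart (ζ t)‖) ^ 2 := by
    gcongr; exact hcone t ht
  refine le_of_sq_le_sq ?_ (by positivity)
  -- The factor `√(1 + ϑ²)` comes from `|x|² + |y|² ≤ (1 + ϑ²)|x|²` in the cone.
  rw [norm_sq_eq_add, mul_pow, mul_pow, Real.sq_sqrt (by positivity)]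
  nlinarith [mul_le_mul_of_nonneg_left h3 (sq_nonneg ϑ)]

end Field

/-! ### The Hamiltonian vector field in the chart -/

/-- `act A` as a continuous linear map. -/
def actL (A : Mat2 n) : Phase n →L[ℝ] Phase n := Matrix.toEuclideanCLM (𝕜 := ℝ) A

@[simp] theorem actL_apply (A : Mat2 n) (z : Phase n) : actL A z = act A z := rfl

theorem act_mul (A B : Mat2 n) (z : Phase n) : act (A * B) z = act A (act B z) := by
  simp [act]

theorem act_one (z : Phase n) : act (1 : Mat2 n) z = z := by
  simp [act]

theorem contDiff_hamField (d : Fin n → ℝ) {G : Conf n → ℝ} (hG : ContDiff ℝ 3 G) :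
    ContDiff ℝ 1 (hamField d G) := by
  have hH : ContDiff ℝ 3 (hamiltonian d G) := by
    have h1 : ContDiff ℝ 3 fun q : Phase n => G (fstPart q) := hG.comp (fstL n).contDiff
    have h2 : ContDiff ℝ 3 fun q : Phase n => ∑ i, (d i)⁻¹ * (q (Sum.inr i)) ^ 2 :=
      ContDiff.sum fun i _ => contDiff_const.mul
        ((EuclideanSpace.proj (Sum.inr i) : Phase n →L[ℝ] ℝ).contDiff.pow 2)
    exact (contDiff_const.mul h2).add h1
  have h1 : ContDiff ℝ 1 (fderiv ℝ (hamiltonian d G)) :=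
    hH.fderiv_right (m := 1) (by norm_num)
  exact (actL _).contDiff.comp
    ((InnerProductSpace.toDual ℝ (Phase n)).symm.toContinuousLinearEquiv.contDiff.comp h1)

theorem contDiff_conjField (d : Fin n → ℝ) {G : Conf n → ℝ} (hG : ContDiff ℝ 3 G) (p₀ : Phase n)
    (A₀ : Mat2 n) : ContDiff ℝ 1 (conjField d G p₀ A₀) :=
  (actL _).contDiff.comp ((contDiff_hamField d hG).comp (contDiff_const.add (actL A₀).contDiff))

theorem chart_zero (p₀ : Phase n) (A₀ : Mat2 n) : chart p₀ A₀ 0 = p₀ := by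
  simp [chart, ← actL_apply]

theorem conjField_zero {d : Fin n → ℝ} {G : Conf n → ℝ} {p₀ : Phase n} (A₀ : Mat2 n)
    (hp₀ : hamField d G p₀ = 0) : conjField d G p₀ A₀ 0 = 0 := by
  rw [conjField, chart_zero, hp₀, ← actL_apply, map_zero]

theorem act_conjField {d : Fin n → ℝ} {G : Conf n → ℝ} {p₀ : Phase n} {A₀ : Mat2 n}
    (hA₀ : IsUnit A₀.det) (z : Phase n) :
    act A₀ (conjField d G p₀ A₀ z) = hamField d G (chart p₀ A₀ z) := by
  rw [conjField, ← act_mul, Matrix.mul_nonsing_inv _ hA₀, act_one]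

/-- An orbit through a point of the local unstable manifold coincides in the past with the image
of the backward orbit of that point. -/
theorem orbit_eq_chart {d : Fin n → ℝ} {G : Conf n → ℝ} (hG : ContDiff ℝ 3 G) {p₀ : Phase n}
    {A₀ : Mat2 n} (hA₀ : IsUnit A₀.det) {φ ζ : ℝ → Phase n}
    (hφ : ∀ x, HasDerivAt φ (hamField d G (φ x)) x)
    (hζ : ∀ t ≤ 0, HasDerivWithinAt ζ (conjField d G p₀ A₀ (ζ t)) (Iic 0) t) {L : ℝ}
    (hL : φ (-L) = chart p₀ A₀ (ζ 0)) {x : ℝ} (hx : x ≤ -L) :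
    φ x = chart p₀ A₀ (ζ (x + L)) := by
  have hψ : ∀ u ≤ -L, HasDerivWithinAt (fun u => chart p₀ A₀ (ζ (u + L)))
      (hamField d G (chart p₀ A₀ (ζ (u + L)))) (Iic (-L)) u := by
    intro u hu
    have h1 : HasDerivWithinAt (fun u : ℝ => u + L) 1 (Iic (-L)) u :=
      ((hasDerivAt_id u).add_const L).hasDerivWithinAt
    have h2 := HasDerivWithinAt.scomp u (hζ (u + L) (by linarith)) h1
      (fun v hv => by simp only [mem_Iic]; linarith [mem_Iic.1 hv])
    have h3 := ((actL A₀).hasFDerivAt.comp_hasDerivWithinAt u h2).const_add p₀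
    simp only [one_smul, actL_apply, act_conjField hA₀] at h3
    exact h3
  have hc1 : ContinuousOn φ (Icc x (-L)) := fun u _ => (hφ u).continuousAt.continuousWithinAt
  have hc2 : ContinuousOn (fun u => chart p₀ A₀ (ζ (u + L))) (Icc x (-L)) := fun u hu =>
    (hψ u hu.2).continuousWithinAt.mono fun v hv => hv.2
  obtain ⟨R₁, hR₁⟩ := isCompact_Icc.exists_bound_of_continuousOn hc1
  obtain ⟨R₂, hR₂⟩ := isCompact_Icc.exists_bound_of_continuousOn hc2
  obtain ⟨K, hK⟩ := exists_lipschitzOnWith_closedBall (contDiff_hamField d hG) (max R₁ R₂)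
  -- Uniqueness runs backward from the common value at `-L`, in a ball containing both compact arcs.
  refine ODE_solution_unique_of_mem_Icc_left (v := fun _ => hamField d G)
    (s := fun _ => Metric.closedBall 0 (max R₁ R₂)) (fun _ _ => hK) hc1
    (fun u _ => (hφ u).hasDerivWithinAt)
    (fun u hu => by
      simpa using Or.inl (hR₁ u (Ioc_subset_Icc_self hu))) hc2
    (fun u hu => (hψ u hu.2).mono (Iic_subset_Iic.2 hu.2))
    (fun u hu => by
      simpa using Or.inr (hR₂ u (Ioc_subset_Icc_self hu))) ?_ ⟨le_rfl, hx⟩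
  simpa using hL

/-! ### The Hessian along the orbit -/

/-- This lets the multilinear norm of `D²G` bound the operator norm of Hessian matrices and their
differences. -/
theorem inner_hess (G : Conf n → ℝ) (v a b : Conf n) :
    inner ℝ a (Matrix.toEuclideanCLM (𝕜 := ℝ) (hess G v) b)
      = iteratedFDeriv ℝ 2 G v ![a, b] := by
  have he : ∀ c : Conf n, c = ∑ i, c i • EuclideanSpace.single i (1 : ℝ) := fun c => by
    conv_lhs => rw [← (EuclideanSpace.basisFun (Fin n) ℝ).sum_repr c]
    simp
  conv_rhs => rw [he a, he b]
  rw [inner_toEuclideanCLM]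
  simp only [iteratedFDeriv_two_apply, Matrix.cons_val_zero, Matrix.cons_val_one, map_sum,
    map_smul, sum_apply, smul_apply, smul_eq_mul, hess, Matrix.of_apply, Finset.mul_sum]
  rw [Finset.sum_comm]
  refine Finset.sum_congr rfl fun j _ => Finset.sum_congr rfl fun i _ => ?_
  ring

theorem norm_hess_sub_le {G : Conf n → ℝ} (hG : ContDiff ℝ 3 G) {v w : Conf n} {C : ℝ}
    (hC : ∀ u ∈ segment ℝ w v, ‖iteratedFDeriv ℝ 3 G u‖ ≤ C) :
    ‖hess G v - hess G w‖ ≤ C * ‖v - w‖ := by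
  have hC0 : 0 ≤ C := (norm_nonneg _).trans (hC w (left_mem_segment ℝ w v))
  have h1 : ‖iteratedFDeriv ℝ 2 G v - iteratedFDeriv ℝ 2 G w‖ ≤ C * ‖v - w‖ :=
    Convex.norm_image_sub_le_of_norm_fderiv_le (𝕜 := ℝ)
      (fun u _ => (hG.differentiable_iteratedFDeriv (m := 2) (by norm_cast)) u)
      (fun u hu => by rw [norm_fderiv_iteratedFDeriv]; exact hC u hu)
      (convex_segment w v) (left_mem_segment ℝ w v) (right_mem_segment ℝ w v)
  refine matrix_norm_le_of_inner (by positivity) fun a b => ?_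
  rw [map_sub, sub_apply, inner_sub_right, inner_hess, inner_hess]
  have h2 := (iteratedFDeriv ℝ 2 G v - iteratedFDeriv ℝ 2 G w).le_opNorm ![a, b]
  simp only [Fin.prod_univ_two, Matrix.cons_val_zero, Matrix.cons_val_one] at h2
  calc _ ≤ ‖iteratedFDeriv ℝ 2 G v - iteratedFDeriv ℝ 2 G w‖ * (‖a‖ * ‖b‖) :=
        (le_abs_self _).trans h2
    _ ≤ C * ‖v - w‖ * (‖a‖ * ‖b‖) := by gcongr
    _ = _ := by ring

theorem continuous_hess {G : Conf n → ℝ} (hG : ContDiff ℝ 3 G) : Continuous (hess G) := by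
  refine continuous_matrix fun i j => ?_
  have h := hG.continuous_iteratedFDeriv (m := 2) (by norm_cast)
  exact h.eval_const ![EuclideanSpace.single i 1, EuclideanSpace.single j 1]

/-- Exponential decay of the Hessian along an orbit through the local unstable manifold. -/
theorem norm_potential_sub_le {d : Fin n → ℝ} {G : Conf n → ℝ} (hG : ContDiff ℝ 3 G)
    {p₀ : Phase n} (hp₀ : hamField d G p₀ = 0) {A₀ : Mat2 n} (hA₀ : IsUnit A₀.det)
    {ru rs ϑ ξ CG L : ℝ} (hϑ : 0 < ϑ)
    (hξ : ξ = rateXi (conjField d G p₀ A₀) (box n ru rs) ϑ)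
    (hμ : rateMu (conjField d G p₀ A₀) (box n ru rs) ϑ < 0) (hξpos : 0 < ξ) {φ : ℝ → Phase n}
    (hφ : ∀ x, HasDerivAt φ (hamField d G (φ x)) x)
    (hφL : φ (-L) ∈ localUnstableAt d G p₀ A₀ (box n ru rs))
    (hCG : ∀ z ∈ box n ru rs, ‖iteratedFDeriv ℝ 3 G (fstPart (chart p₀ A₀ z))‖ ≤ CG)
    {x : ℝ} (hx : x ≤ -L) :
    ‖potential G φ x - hess G (fstPart p₀)‖
      ≤ CG * ru * ‖A₀‖ * √(1 + ϑ ^ 2) * Real.exp (ξ * L) * Real.exp (ξ * x) := by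
  subst hξ
  obtain ⟨z, ⟨ζ, rfl, hζ, hbox, hlim⟩, hz⟩ := hφL
  have hxL : x + L ≤ 0 := by linarith
  have heq := orbit_eq_chart hG hA₀ hφ hζ hz.symm hx
  have hdecay := backward_orbit_norm_le (contDiff_conjField d hG p₀ A₀) (conjField_zero A₀ hp₀)
    hϑ hμ hξpos hζ hbox hlim hxL
  have hCG0 : 0 ≤ CG := (norm_nonneg _).trans (hCG _ (hbox _ hxL))
  have hchart : ∀ w, fstPart (chart p₀ A₀ w) = fstPart p₀ + fstPart (act A₀ w) := fun w =>
    (fstL n).map_add p₀ (act A₀ w)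
  -- The segment is the image under the affine map `π₁ψ` of the one from `0` to `ζ (x + L)`, which
  -- lies in the convex box where `CG` applies.
  have hseg : ∀ u ∈ segment ℝ (fstPart p₀) (fstPart (φ x)), ‖iteratedFDeriv ℝ 3 G u‖ ≤ CG := by
    intro u hu
    rw [segment_eq_image'] at hu
    obtain ⟨s, hs, rfl⟩ := hu
    have h1 : fstPart p₀ + s • (fstPart (φ x) - fstPart p₀)
        = fstPart (chart p₀ A₀ (s • ζ (x + L))) := by
      rw [heq, hchart, hchart, add_sub_cancel_left]
      congr 1
      simp only [← fstL_apply, ← actL_apply, map_smul]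
    simp only [h1]
    exact hCG _ (smul_mem_box (hbox _ hxL) hs)
  calc _ ≤ CG * ‖fstPart (φ x) - fstPart p₀‖ := norm_hess_sub_le hG hseg
    _ = CG * ‖fstPart (act A₀ (ζ (x + L)))‖ := by rw [heq, hchart, add_sub_cancel_left]
    _ ≤ CG * (‖A₀‖ * (ru * √(1 + ϑ ^ 2) *
          Real.exp (rateXi (conjField d G p₀ A₀) (box n ru rs) ϑ * (x + L)))) := by
        gcongr
        exact (norm_fstPart_le _).trans ((norm_act_le _ _).trans (by gcongr))
    _ = _ := by rw [mul_add, Real.exp_add]; ring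

/-! ### Exponentials of diagonalizable matrices -/

/-- Conjugation by `Q` makes both the exponential and the projection diagonal. -/
theorem exp_mul_spectral {A Q : Mat2 n} {ev : Fin n ⊕ Fin n → ℝ} (hQ : IsEigenvectorMatrix A Q ev)
    (ν t : ℝ) (p : Fin n ⊕ Fin n → ℝ) :
    NormedSpace.exp (t • (A - ν • (1 : Mat2 n))) * (Q * Matrix.diagonal p * Q⁻¹)
      = Q * Matrix.diagonal (fun j => Real.exp (t * (ev j - ν)) * p j) * Q⁻¹ := by
  obtain ⟨hdet, hAQ⟩ := hQ
  have hU : IsUnit Q := (Matrix.isUnit_iff_isUnit_det Q).2 hdet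
  have hQQ : Q * Q⁻¹ = 1 := Matrix.mul_nonsing_inv _ hdet
  have hQQ' : Q⁻¹ * Q = 1 := Matrix.nonsing_inv_mul _ hdet
  have hA : A = Q * Matrix.diagonal ev * Q⁻¹ := by
    rw [← hAQ, mul_assoc, hQQ, mul_one]
  have h1 : t • (A - ν • (1 : Mat2 n))
      = Q * Matrix.diagonal (fun j => t * (ev j - ν)) * Q⁻¹ := by
    have h2 : Matrix.diagonal (fun j => t * (ev j - ν))
        = t • (Matrix.diagonal ev - ν • (1 : Mat2 n)) := by
      ext i j
      by_cases h : i = j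
      · subst h; simp
      · simp [h]
    rw [h2, hA, Matrix.mul_smul, Matrix.smul_mul, mul_sub, sub_mul, Matrix.mul_smul,
      Matrix.smul_mul, mul_one, hQQ]
  rw [h1, Matrix.exp_conj _ _ hU, Matrix.exp_diagonal]
  calc _ = Q * (Matrix.diagonal (NormedSpace.exp fun j => t * (ev j - ν)) * (Q⁻¹ * Q)
          * Matrix.diagonal p) * Q⁻¹ := by simp only [mul_assoc]
    _ = _ := by
      rw [hQQ', mul_one, Matrix.diagonal_mul_diagonal]
      congr 3
      ext j
      rw [Pi.coe_exp, Real.exp_eq_exp_ℝ]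

theorem norm_spectral_le (Q : Mat2 n) {v : Fin n ⊕ Fin n → ℝ} (hv : ∀ j, |v j| ≤ 1) :
    ‖Q * Matrix.diagonal v * Q⁻¹‖ ≤ kMinus Q := by
  have h1 : ‖Matrix.diagonal v‖ ≤ 1 := by
    rw [Matrix.l2_opNorm_diagonal]
    exact (pi_norm_le_iff_of_nonneg zero_le_one).2 hv
  calc _ ≤ ‖Q‖ * ‖Matrix.diagonal v‖ * ‖Q⁻¹‖ :=
        (norm_mul_le _ _).trans (by gcongr; exact norm_mul_le _ _)
    _ ≤ ‖Q‖ * 1 * ‖Q⁻¹‖ := by gcongr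
    _ = _ := by rw [mul_one, kMinus]

/-- The projection retains only exponents `t(ev j - ν) ≤ 0`. No spectral gap is used; convergence of
the integrals comes from the decay of `𝓐₋` alone. -/
theorem norm_exp_mul_projCS_le {A Q : Mat2 n} {ev : Fin n ⊕ Fin n → ℝ}
    (hQ : IsEigenvectorMatrix A Q ev) (ν : ℝ) {t : ℝ} (ht : 0 ≤ t) :
    ‖NormedSpace.exp (t • (A - ν • (1 : Mat2 n))) * projCS Q ev ν‖ ≤ kMinus Q := by
  rw [projCS, exp_mul_spectral hQ]
  refine norm_spectral_le Q fun j => ?_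
  split_ifs with h
  · rw [mul_one, Real.abs_exp, Real.exp_le_one_iff]
    exact mul_nonpos_of_nonneg_of_nonpos ht (sub_nonpos.2 h)
  · simp

theorem norm_exp_mul_projU_le {A Q : Mat2 n} {ev : Fin n ⊕ Fin n → ℝ}
    (hQ : IsEigenvectorMatrix A Q ev) (ν : ℝ) {t : ℝ} (ht : t ≤ 0) :
    ‖NormedSpace.exp (t • (A - ν • (1 : Mat2 n))) * projU Q ev ν‖ ≤ kMinus Q := by
  rw [projU, exp_mul_spectral hQ]
  refine norm_spectral_le Q fun j => ?_
  split_ifs with h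
  · rw [mul_one, Real.abs_exp, Real.exp_le_one_iff]
    exact mul_nonpos_of_nonpos_of_nonneg ht (sub_nonneg.2 h.le)
  · simp

/-! ### The kernel of the integral operator -/

theorem norm_kernelTerm_le {A P : Mat2 n} {ν K b : ℝ} {B : ℝ → Mat2 n} {W : ℝ → Phase n}
    {x y : ℝ} (hK : ‖NormedSpace.exp ((x - y) • (A - ν • (1 : Mat2 n))) * P‖ ≤ K)
    (hb : ‖B y‖ ≤ b) : ‖kernelTerm A P ν B W x y‖ ≤ K * b * ‖W y‖ := by
  have hK0 : 0 ≤ K := (norm_nonneg _).trans hK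
  refine (norm_act_le _ _).trans ?_
  gcongr
  exact (norm_mul_le _ _).trans (by gcongr)

theorem kernelTerm_sub (A P : Mat2 n) (ν : ℝ) (B : ℝ → Mat2 n) (W₁ W₂ : ℝ → Phase n) (x y : ℝ) :
    kernelTerm A P ν B (W₁ - W₂) x y = kernelTerm A P ν B W₁ x y - kernelTerm A P ν B W₂ x y :=
  (actL _).map_sub _ _

theorem stronglyMeasurable_clm_apply {X E F : Type*} [TopologicalSpace X] [MeasurableSpace X]
    [OpensMeasurableSpace X] [SecondCountableTopology X] [NormedAddCommGroup E] [NormedSpace ℝ E]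
    [NormedAddCommGroup F] [NormedSpace ℝ F] {Λ : X → E →L[ℝ] F} (hΛ : Continuous Λ) {g : X → E}
    (hg : StronglyMeasurable g) [TopologicalSpace.PseudoMetrizableSpace X] :
    StronglyMeasurable fun q => Λ q (g q) :=
  isBoundedBilinearMap_apply.continuous.comp_stronglyMeasurable (hΛ.stronglyMeasurable.prodMk hg)

/-- An indicator on the product turns the moving domain into a fixed one; this handles the limits
depending on `x` in `tMinus`. -/
theorem stronglyMeasurable_setIntegral_prod {E : Type*} [NormedAddCommGroup E] [NormedSpace ℝ E]
    {F : ℝ × ℝ → E} (hF : StronglyMeasurable F) {s : Set (ℝ × ℝ)} (hs : MeasurableSet s) :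
    StronglyMeasurable fun x => ∫ y in {y | (x, y) ∈ s}, F (x, y) := by
  have h := StronglyMeasurable.integral_prod_right' (ν := (volume : Measure ℝ)) (hF.indicator hs)
  convert h using 2 with x
  exact (integral_indicator (measurable_prodMk_left hs)).symm

theorem continuous_exp_smul (M : Mat2 n) :
    Continuous fun t : ℝ => NormedSpace.exp (t • M) :=
  continuous_iff_continuousAt.2 fun t => (hasDerivAt_exp_smul_const M t).continuousAt

theorem continuous_actL : Continuous fun M : Mat2 n => actL M :=
  LinearMap.continuous_of_finiteDimensional
    ({ toFun := actL
       map_add' := fun M N => map_add (Matrix.toEuclideanCLM (𝕜 := ℝ)) M N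
       map_smul' := fun c M => map_smul (Matrix.toEuclideanCLM (𝕜 := ℝ)) c M } :
      Mat2 n →ₗ[ℝ] Phase n →L[ℝ] Phase n)

theorem stronglyMeasurable_kernelTerm (A P : Mat2 n) (ν : ℝ) {B : ℝ → Mat2 n} (hB : Continuous B)
    {W : ℝ → Phase n} (hW : StronglyMeasurable W) :
    StronglyMeasurable fun q : ℝ × ℝ => kernelTerm A P ν B W q.1 q.2 := by
  have hM : Continuous fun q : ℝ × ℝ =>
      NormedSpace.exp ((q.1 - q.2) • (A - ν • (1 : Mat2 n))) * P * B q.2 :=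
    (((continuous_exp_smul (A - ν • (1 : Mat2 n))).comp
      (continuous_fst.sub continuous_snd)).mul continuous_const).mul (hB.comp continuous_snd)
  exact stronglyMeasurable_clm_apply (continuous_actL.comp hM) (hW.comp_measurable measurable_snd)

theorem stronglyMeasurable_kernelTerm_right (A P : Mat2 n) (ν : ℝ) {B : ℝ → Mat2 n}
    (hB : Continuous B) {W : ℝ → Phase n} (hW : StronglyMeasurable W) (x : ℝ) :
    StronglyMeasurable (kernelTerm A P ν B W x) := by
  have h := (stronglyMeasurable_kernelTerm A P ν hB hW).comp_measurable
    (measurable_const.prodMk measurable_id : Measurable fun y : ℝ => (x, y))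
  exact h

theorem stronglyMeasurable_tMinus (A Pcs Pu : Mat2 n) (ν : ℝ) (V : Phase n) {B : ℝ → Mat2 n}
    (hB : Continuous B) (L : ℝ) {W : ℝ → Phase n} (hW : StronglyMeasurable W) :
    StronglyMeasurable (tMinus A Pcs Pu ν V B L W) := by
  have key : ∀ (P : Mat2 n) (s : Set (ℝ × ℝ)), MeasurableSet s →
      StronglyMeasurable fun x => ∫ y in {y | (x, y) ∈ s}, kernelTerm A P ν B W x y :=
    fun P s hs => stronglyMeasurable_setIntegral_prod (stronglyMeasurable_kernelTerm A P ν hB hW) hs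
  have h1 := key Pcs {q | q.2 ≤ q.1} (measurableSet_le measurable_snd measurable_fst)
  have h2 := key Pu {q | q.1 < q.2 ∧ q.2 ≤ -L}
    ((measurableSet_lt measurable_fst measurable_snd).inter
      (measurableSet_le measurable_snd measurable_const))
  -- For `x > -L` the interval integral has reversed orientation; global measurability needs this
  -- piece as well.
  have h3 := key Pu {q | -L < q.2 ∧ q.2 ≤ q.1}
    ((measurableSet_lt measurable_const measurable_snd).inter
      (measurableSet_le measurable_snd measurable_fst))
  exact (stronglyMeasurable_const.add h1).sub (h2.sub h3)

/-! ### The integral operator on `L^∞` -/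

theorem ae_norm_le_norm_of_Lp_top {α E : Type*} [MeasurableSpace α] {m : Measure α}
    [NormedAddCommGroup E] (W : Lp E ∞ m) : ∀ᵐ y ∂m, ‖W y‖ ≤ ‖W‖ := by
  filter_upwards [ae_le_eLpNormEssSup (f := W) (μ := m)] with y hy
  rw [Lp.norm_def, eLpNorm_exponent_top, ← toReal_enorm]
  refine ENNReal.toReal_mono ?_ hy
  rw [← eLpNorm_exponent_top]
  exact Lp.eLpNorm_ne_top W

theorem norm_Lp_top_le_of_ae_bound {α E : Type*} [MeasurableSpace α] {m : Measure α}
    [NormedAddCommGroup E] {W : Lp E ∞ m} {c : ℝ} (hc : 0 ≤ c) (h : ∀ᵐ y ∂m, ‖W y‖ ≤ c) :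
    ‖W‖ ≤ c := by
  rw [Lp.norm_def, eLpNorm_exponent_top]
  exact ENNReal.toReal_le_of_le_ofReal hc (eLpNormEssSup_le_of_ae_bound h)

theorem integrableOn_and_norm_setIntegral_le {E : Type*} [NormedAddCommGroup E] [NormedSpace ℝ E]
    {k : ℝ → E} {c η b : ℝ} (hη : 0 < η) {s : Set ℝ} (hsub : s ⊆ Iic b)
    (hk : StronglyMeasurable k)
    (hbound : ∀ᵐ y ∂volume.restrict s, ‖k y‖ ≤ c * Real.exp (η * y)) :
    IntegrableOn k s ∧ ‖∫ y in s, k y‖ ≤ c * ∫ y in s, Real.exp (η * y) := by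
  have hint : IntegrableOn (fun y => c * Real.exp (η * y)) s :=
    ((integrableOn_exp_mul_Iic hη b).mono_set hsub).const_mul _
  refine ⟨Integrable.mono' hint hk.aestronglyMeasurable hbound, ?_⟩
  rw [← integral_const_mul]
  exact norm_integral_le_of_norm_le hint hbound

section Operator

variable {A Q : Mat2 n} {ev : Fin n ⊕ Fin n → ℝ} {B : ℝ → Mat2 n} {ν L C η : ℝ}

theorem integrableOn_kernelTerm_and_bound (hη : 0 < η) {P : Mat2 n} {K w : ℝ} {s : Set ℝ}
    (hs : MeasurableSet s) (hsub : s ⊆ Iic (-L)) {x : ℝ} (hBc : Continuous B)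
    (hB : ∀ y ≤ -L, ‖B y‖ ≤ C * Real.exp (η * y))
    (hK : ∀ y ∈ s, ‖NormedSpace.exp ((x - y) • (A - ν • (1 : Mat2 n))) * P‖ ≤ K)
    {W : ℝ → Phase n} (hW : StronglyMeasurable W)
    (hWb : ∀ᵐ y ∂volume.restrict (Iic (-L)), ‖W y‖ ≤ w) :
    IntegrableOn (kernelTerm A P ν B W x) s ∧
      ‖∫ y in s, kernelTerm A P ν B W x y‖ ≤ K * C * w * ∫ y in s, Real.exp (η * y) := by
  have hbound : ∀ᵐ y ∂volume.restrict s,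
      ‖kernelTerm A P ν B W x y‖ ≤ K * C * w * Real.exp (η * y) := by
    filter_upwards [ae_restrict_of_ae_restrict_of_subset hsub hWb, ae_restrict_mem hs]
      with y hy hys
    have hK0 : 0 ≤ K := (norm_nonneg _).trans (hK y hys)
    have hb0 : 0 ≤ C * Real.exp (η * y) := (norm_nonneg _).trans (hB y (hsub hys))
    calc _ ≤ K * (C * Real.exp (η * y)) * ‖W y‖ :=
          norm_kernelTerm_le (hK y hys) (hB y (hsub hys))
      _ ≤ K * (C * Real.exp (η * y)) * w := by gcongr
      _ = _ := by ring
  exact integrableOn_and_norm_setIntegral_le hη hsub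
    (stronglyMeasurable_kernelTerm_right A P ν hBc hW x) hbound

/-- The ranges `(-∞, x]` and `(x, -L]` are disjoint with union `(-∞, -L]`, so the two bounds add up
to one integral `e^{-ηL}/η`, uniform in `x` and without a factor `2`. -/
theorem kernel_integrals_and_bound (hQ : IsEigenvectorMatrix A Q ev) (hη : 0 < η)
    (hBc : Continuous B) (hB : ∀ y ≤ -L, ‖B y‖ ≤ C * Real.exp (η * y))
    {W : ℝ → Phase n} {w : ℝ} (hW : StronglyMeasurable W)
    (hWb : ∀ᵐ y ∂volume.restrict (Iic (-L)), ‖W y‖ ≤ w) {x : ℝ} (hx : x ≤ -L) :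
    IntegrableOn (kernelTerm A (projCS Q ev ν) ν B W x) (Iic x) ∧
      IntervalIntegrable (kernelTerm A (projU Q ev ν) ν B W x) volume x (-L) ∧
      ‖(∫ y in Iic x, kernelTerm A (projCS Q ev ν) ν B W x y)
        - ∫ y in x..(-L), kernelTerm A (projU Q ev ν) ν B W x y‖
        ≤ kMinus Q * C / η * Real.exp (-η * L) * w := by
  obtain ⟨h1, h2⟩ := integrableOn_kernelTerm_and_bound (ν := ν) (P := projCS Q ev ν) hη
    measurableSet_Iic (Iic_subset_Iic.2 hx) hBc hB
    (fun y hy => norm_exp_mul_projCS_le hQ ν (sub_nonneg.2 (mem_Iic.1 hy))) hW hWb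
  obtain ⟨h3, h4⟩ := integrableOn_kernelTerm_and_bound (ν := ν) (P := projU Q ev ν) hη
    measurableSet_Ioc Ioc_subset_Iic_self hBc hB
    (fun y (hy : y ∈ Ioc x (-L)) => norm_exp_mul_projU_le hQ ν (sub_nonpos.2 hy.1.le)) hW hWb
  refine ⟨h1, (intervalIntegrable_iff_integrableOn_Ioc_of_le hx).2 h3, ?_⟩
  rw [intervalIntegral.integral_of_le hx]
  refine (norm_sub_le _ _).trans ((add_le_add h2 h4).trans (le_of_eq ?_))
  have hE := integrableOn_exp_mul_Iic hη (-L)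
  rw [← mul_add, ← setIntegral_union (Iic_disjoint_Ioc le_rfl) measurableSet_Ioc
    (hE.mono_set (Iic_subset_Iic.2 hx)) (hE.mono_set Ioc_subset_Iic_self),
    Iic_union_Ioc_eq_Iic hx, integral_exp_mul_Iic hη, mul_neg, neg_mul]
  ring

theorem tMinusLipschitz_of_exp_decay (hQ : IsEigenvectorMatrix A Q ev) (hη : 0 < η) (hC : 0 ≤ C)
    (hBc : Continuous B) (hB : ∀ y ≤ -L, ‖B y‖ ≤ C * Real.exp (η * y)) (ν : ℝ) (V : Phase n) :
    TMinusLipschitz A (projCS Q ev ν) (projU Q ev ν) ν V B L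
      (lambdaMinus (kMinus Q) C η L) := by
  have hK : 0 ≤ kMinus Q := mul_nonneg (norm_nonneg _) (norm_nonneg _)
  have hlam : 0 ≤ lambdaMinus (kMinus Q) C η L := by unfold lambdaMinus; positivity
  have hker := fun (W : XSpace n L) x (hx : x ≤ -L) =>
    kernel_integrals_and_bound (ν := ν) hQ hη hBc hB (Lp.stronglyMeasurable W)
      (ae_norm_le_norm_of_Lp_top W) hx
  refine ⟨fun W x hx => ⟨(hker W x hx).1, (hker W x hx).2.1⟩, ?_⟩
  have hmem : ∀ W : XSpace n L, MemLp (tMinus A (projCS Q ev ν) (projU Q ev ν) ν V B L W) ∞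
      (volume.restrict (Iic (-L))) := by
    intro W
    refine memLp_top_of_bound
      (stronglyMeasurable_tMinus A _ _ ν V hBc L (Lp.stronglyMeasurable W)).aestronglyMeasurable
      (‖V‖ + lambdaMinus (kMinus Q) C η L * ‖W‖) ?_
    filter_upwards [ae_restrict_mem measurableSet_Iic] with x hx
    rw [tMinus, add_sub_assoc]
    exact (norm_add_le _ _).trans (add_le_add_right (hker W x hx).2.2 _)
  refine ⟨fun W => (hmem W).toLp _, fun W => (hmem W).coeFn_toLp, fun W₁ W₂ => ?_⟩
  refine norm_Lp_top_le_of_ae_bound (by positivity) ?_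
  -- The kernel bound is applied to the difference of representatives, for which linearity is
  -- pointwise; `V` cancels in `𝓣₋(W₁) - 𝓣₋(W₂)`.
  have hdiff : ∀ᵐ y ∂volume.restrict (Iic (-L)), ‖(W₁ - W₂ : ℝ → Phase n) y‖ ≤ ‖W₁ - W₂‖ := by
    filter_upwards [ae_norm_le_norm_of_Lp_top (W₁ - W₂), Lp.coeFn_sub W₁ W₂] with y h1 h2
    rwa [← h2]
  filter_upwards [Lp.coeFn_sub ((hmem W₁).toLp _) ((hmem W₂).toLp _), (hmem W₁).coeFn_toLp,
    (hmem W₂).coeFn_toLp, ae_restrict_mem measurableSet_Iic] with x e1 e2 e3 hx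
  obtain ⟨i1, j1, -⟩ := hker W₁ x hx
  obtain ⟨i2, j2, -⟩ := hker W₂ x hx
  obtain ⟨-, -, hb⟩ := kernel_integrals_and_bound (ν := ν) hQ hη hBc hB
    ((Lp.stronglyMeasurable W₁).sub (Lp.stronglyMeasurable W₂)) hdiff hx
  simp only [kernelTerm_sub] at hb
  rw [integral_sub i1 i2, intervalIntegral.integral_sub j1 j2] at hb
  rw [e1, Pi.sub_apply, e2, e3]
  refine le_trans (le_of_eq ?_) hb
  simp only [tMinus]
  congr 1
  abel

end Operator

end StandingWave

end

theorem theorem3p2 (n : ℕ) (hn : 1 ≤ n)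
    -- the diffusion matrix and the potential
    (d : Fin n → ℝ) (hd : ∀ i, 0 < d i)
    (G : Conf n → ℝ) (hG : ContDiff ℝ 3 G)
    -- the equilibrium and the linear change of coordinates
    (p₀ : Phase n) (hp₀ : hamField d G p₀ = 0)
    (A₀ : Mat2 n) (hA₀ : IsUnit A₀.det)
    -- the box and the rate constants
    (ru ϑ rs : ℝ) (hru : 0 < ru) (hϑ : 0 < ϑ) (hrs : rs = ϑ * ru)
    (ξ : ℝ) (hξ : ξ = rateXi (conjField d G p₀ A₀) (box n ru rs) ϑ)
    -- the hypotheses of the unstable manifold theorem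
    (hexit : ∀ q : Phase n, ‖fstPart q‖ = ru → ‖sndPart q‖ ≤ rs →
      0 < inner ℝ (fstPart (conjField d G p₀ A₀ q)) (fstPart q))
    (hentry : ∀ q : Phase n, ‖fstPart q‖ ≤ ru → ‖sndPart q‖ = rs →
      inner ℝ (sndPart (conjField d G p₀ A₀ q)) (sndPart q) < 0)
    (hμ : rateMu (conjField d G p₀ A₀) (box n ru rs) ϑ < 0)
    (hξpos : 0 < ξ)
    -- the heteroclinic orbit
    (p₁ : Phase n) (φ : ℝ → Phase n) (hφ : IsHeteroclinicOrbit d G p₀ p₁ φ)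
    (L : ℝ) (hL : 0 ≤ L)
    (hφL : φ (-L) ∈ localUnstableAt d G p₀ A₀ (box n ru rs))
    -- the bound on the third derivative of the potential on the box
    (CG : ℝ) (hCG : ∀ z ∈ box n ru rs, ‖iteratedFDeriv ℝ 3 G (fstPart (chart p₀ A₀ z))‖ ≤ CG)
    -- the matrix of eigenvectors that defines `K₋`
    (Q : Mat2 n) (ev : Fin n ⊕ Fin n → ℝ)
    (hQ : IsEigenvectorMatrix (asymMatrix d (hess G (fstPart p₀))) Q ev) :
    ∃ CM ηM : ℝ,
      ηM = ξ ∧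
      CM = CG * ru * ‖A₀‖ * √(1 + ϑ ^ 2) * Real.exp (ξ * L) ∧
      -- the exponential decay with these constants
      (∀ x ≤ -L, ‖potential G φ x - hess G (fstPart p₀)‖ ≤ CM * Real.exp (-ηM * |x|)) ∧
      (∀ x ≤ -L, ‖pertMatrix (potential G φ) (hess G (fstPart p₀)) x‖
        ≤ CM * Real.exp (-ηM * |x|)) ∧
      -- `λ_{𝓣₋}` is a Lipschitz constant of `𝓣₋`, for every eigenpair of `𝓐₋∞`
      (∀ (ν : ℝ) (V : Phase n), V ≠ 0 →
        act (asymMatrix d (hess G (fstPart p₀))) V = ν • V →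
        TMinusLipschitz (asymMatrix d (hess G (fstPart p₀))) (projCS Q ev ν) (projU Q ev ν) ν V
          (pertMatrix (potential G φ) (hess G (fstPart p₀))) L
          (lambdaMinus (kMinus Q) CM ηM L)) ∧
      -- the bound on the contraction constant
      lambdaMinus (kMinus Q) CM ηM L
        ≤ ξ⁻¹ * kMinus Q * CG * ru * ‖A₀‖ * √(1 + ϑ ^ 2) := by
  have hrs0 : 0 ≤ rs := hrs ▸ (mul_pos hϑ hru).le
  have hCG0 : 0 ≤ CG := (norm_nonneg _).trans (hCG 0 (zero_mem_box hru.le hrs0))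
  set CM := CG * ru * ‖A₀‖ * √(1 + ϑ ^ 2) * Real.exp (ξ * L) with hCM
  have hCM0 : 0 ≤ CM := by positivity
  have hdecay : ∀ x ≤ -L,
      ‖potential G φ x - hess G (fstPart p₀)‖ ≤ CM * Real.exp (ξ * x) := fun x hx =>
    norm_potential_sub_le hG hp₀ hA₀ hϑ hξ hμ hξpos hφ.solution hφL hCG hx
  have hpert : ∀ x ≤ -L,
      ‖pertMatrix (potential G φ) (hess G (fstPart p₀)) x‖ ≤ CM * Real.exp (ξ * x) := by
    intro x hx
    refine (norm_fromBlocks_lower_left_le _).trans ?_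
    rw [neg_add_eq_sub, norm_sub_rev]
    exact hdecay x hx
  have habs : ∀ x ≤ -L, -ξ * |x| = ξ * x := fun x hx => by
    rw [abs_of_nonpos (by linarith), neg_mul_neg]
  have hφc : Continuous φ := continuous_iff_continuousAt.2 fun x => (hφ.solution x).continuousAt
  have hMc : Continuous (potential G φ) :=
    (continuous_hess hG).comp ((fstL n).continuous.comp hφc)
  have hBc : Continuous (pertMatrix (potential G φ) (hess G (fstPart p₀))) :=
    continuous_const.matrix_fromBlocks continuous_const (hMc.neg.add continuous_const)
      continuous_const
  refine ⟨CM, ξ, rfl, rfl, fun x hx => ?_, fun x hx => ?_, fun ν V _ _ => ?_, le_of_eq ?_⟩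
  · rw [habs x hx]; exact hdecay x hx
  · rw [habs x hx]; exact hpert x hx
  · exact tMinusLipschitz_of_exp_decay hQ hξpos hCM0 hBc hpert ν V
  -- The `e^{ξL}` in `CM` cancels the `e^{-ξL}` in `lambdaMinus`, so the last bound is an equality.
  · have h1 : Real.exp (ξ * L) * Real.exp (-ξ * L) = 1 := by
      rw [← Real.exp_add, neg_mul, add_neg_cancel, Real.exp_zero]
    rw [lambdaMinus, hCM]
    linear_combination (ξ⁻¹ * kMinus Q * CG * ru * ‖A₀‖ * √(1 + ϑ ^ 2)) * h1
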